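/- Let $n\ge 2$ and $m\ge 1$ be integers and let $0<\alpha<2$; write $[\alpha]$ for the integer part of $\alpha$ and $\{\alpha\}=\alpha-[\alpha]$. Let $u:\mathbb{R}^n\to[0,\infty)$ satisfy $u\in C^{2m+[\alpha],\{\alpha\}+\epsilon}_{loc}(\mathbb{R}^n)$ for some $\epsilon>0$ with $\{\alpha\}+\epsilon<1$, and $$\int_{\mathbb{R}^n}\frac{|u(x)|}{1+|x|^{n+\alpha}}\,dx<\infty .$$ Put $$(-\Delta)^{\frac{\alpha}{2}}u(x)=C_{n,\alpha}\lim_{\varepsilon\to0^+}\int_{|y-x|\ge\varepsilon}\frac{u(x)-u(y)}{|x-y|^{n+\alpha}}\,dy,\qquad C_{n,\alpha}=\frac{\alpha\,2^{\alpha-1}\,\Gamma\!\left(\frac{n+\alpha}{2}\right)}{\pi^{n/2}\,\Gamma\!\left(1-\frac{\alpha}{2}\right)},$$ and $(-\Delta)^{i+\frac{\alpha}{2}}u:=(-\Delta)^i(-\Delta)^{\frac{\alpha}{2}}u$ for integers $i\geq 0$. Suppose that $$(-\Delta)^{m+\frac{\alpha}{2}}u(x)=f(x,u,Du,\dots)\qquad\text{for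 all }x\in\mathbb{R}^n,$$ where $f(x,u,Du,\dots)$, which may depend on $x$, $u$ and derivatives of $u$, is continuous in $x\in\mathbb{R}^n$ and $f\le 0$ (both taken along $u$, that is, for the function $x\mapsto f(x,u(x),Du(x),\dots)$). Then the limit defining $(-\Delta)^{\frac{\alpha}{2}}u(x)$ exists for every $x\in\mathbb{R}^n$, $(-\Delta)^{\frac{\alpha}{2}}u\in C^{2m}(\mathbb{R}^n)$ (so that all the operators above are well defined pointwise), and for every $i=0,1,\dots,m-1$, $$(-\Delta)^{i+\frac{\alpha}{2}}u(x)\le 0\qquad\text{for all }x\in\mathbb{R}^n .$$ -/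

import Mathlib

open MeasureTheory Filter Topology InnerProductSpace
open scoped NNReal

noncomputable section

namespace HigherFrac

/-- Euclidean space `ℝⁿ`. -/
abbrev Rn (n : ℕ) : Type := EuclideanSpace ℝ (Fin n)

/-- The local Hölder class `C^{k,β}_loc(ℝⁿ)`: `u` is `C^k` and its `k`-th derivative is
`β`-Hölder continuous on every compact set. -/
def HolderLoc {n : ℕ} (k : ℕ) (β : ℝ≥0) (u : Rn n → ℝ) : Prop :=
  ContDiff ℝ k u ∧
    ∀ K : Set (Rn n), IsCompact K → ∃ C : ℝ≥0, HolderOnWith C β (iteratedFDeriv ℝ k u) K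

/-- The class `C^{k+[α],{α}+ε}_loc(ℝⁿ)` for some `ε > 0`, with `ε` so small that the Hölder
exponent `{α} + ε` is less than one. -/
def FracRegular {n : ℕ} (k : ℕ) (α : ℝ) (u : Rn n → ℝ) : Prop :=
  ∃ ε : ℝ, 0 < ε ∧ Int.fract α + ε < 1 ∧
    HolderLoc (k + ⌊α⌋₊) (Int.fract α + ε).toNNReal u

/-- The weighted space `𝓛_α(ℝⁿ)`: `∫ |u(x)| / (1 + |x|^{n+α}) dx < ∞`. -/
def InWeightedL1 {n : ℕ} (α : ℝ) (u : Rn n → ℝ) : Prop :=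
  Integrable (fun x : Rn n => |u x| / (1 + ‖x‖ ^ ((n : ℝ) + α))) volume

/-- The normalizing constant `C_{n,α} = α 2^{α-1} Γ((n+α)/2) / (π^{n/2} Γ(1-α/2))`, which is
positive for `0 < α < 2`. -/
def fracConst (n : ℕ) (α : ℝ) : ℝ :=
  α * 2 ^ (α - 1) * Real.Gamma (((n : ℝ) + α) / 2) /
    (Real.pi ^ ((n : ℝ) / 2) * Real.Gamma (1 - α / 2))

/-- The truncated singular integral
`C_{n,α} ∫_{|y-x| ≥ ε} (u(x) - u(y)) / |x-y|^{n+α} dy`. -/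
def truncFracLaplacian {n : ℕ} (α : ℝ) (u : Rn n → ℝ) (x : Rn n) (ε : ℝ) : ℝ :=
  fracConst n α *
    ∫ y in {y : Rn n | ε ≤ ‖y - x‖}, (u x - u y) / ‖x - y‖ ^ ((n : ℝ) + α)

/-- The fractional Laplacian `(-Δ)^{α/2} u(x)`: the principal value, that is, the limit of the
truncated integrals as `ε → 0⁺`. -/
def fracLaplacian {n : ℕ} (α : ℝ) (u : Rn n → ℝ) (x : Rn n) : ℝ :=
  limUnder (𝓝[>] (0 : ℝ)) (truncFracLaplacian α u x)

/-- The operator `-Δ`. -/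
def negLaplacian {n : ℕ} (v : Rn n → ℝ) : Rn n → ℝ := fun x => -(Laplacian.laplacian v x)

/-- `(-Δ)^{i+α/2} u := (-Δ)^i ((-Δ)^{α/2} u)`. -/
def higherFracLaplacian {n : ℕ} (i : ℕ) (α : ℝ) (u : Rn n → ℝ) : Rn n → ℝ :=
  negLaplacian^[i] (fracLaplacian α u)

/-- `u` is a nonnegative classical solution of `(-Δ)^{m+α/2} u(x) = f(x, u, Du, …)` in `ℝⁿ`.
The second argument of `f` is the sequence of all derivatives of `u` at `x`, its entry of order
zero being the value `u(x)`. -/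
structure IsNonnegClassicalSolution {n : ℕ} (m : ℕ) (α : ℝ)
    (f : Rn n → FormalMultilinearSeries ℝ (Rn n) ℝ → ℝ) (u : Rn n → ℝ) : Prop where
  regular : FracRegular (2 * m) α u
  weighted : InWeightedL1 α u
  nonneg : ∀ x, 0 ≤ u x
  equation : ∀ x, higherFracLaplacian m α u x = f x (ftaylorSeries ℝ u x)

end HigherFrac

end

/-! Write s = n + α and w for the fractional Laplacian of u. Pairing z with -z turns the principal
value into the absolutely convergent integral of ‖z‖^(-s) (2u(x) - u(x+z) - u(x-z)), up to a
constant factor. Splitting ‖z‖^(-s) by a cutoff gives regularity: near the origin the derivatives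
fall on u, whose second differences are O(‖z‖^β) with s < n + β; away from it they fall on the
smooth decaying kernel, so the weighted integrability of u suffices. Hence w is C^(2m).

The sign comes from a Liouville-type argument. The singular integral is symmetric against test
functions, and it sends a test function to one decaying like (1+‖x‖)^(-s), exactly the weight in
which u is integrable. Rescaling the test function by R then shows that the averages of w at scale R
tend to 0 (`IsAdmissible.averagesVanish`). Two integrations by parts pass this on to each iterated
Laplacian of w, with a further gain R^(-2) (`AveragesVanish.laplacian`).

If v is subharmonic, its averages against a suitable radial weight are nondecreasing in R; at R = 0
they are a positive multiple of v(x₀), and at infinity they vanish, so v(x₀) ≤ 0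
(`AveragesVanish.nonpos`). Descending induction from order m, where the equation and f ≤ 0 give the
sign, settles every lower order. -/

noncomputable section

namespace HigherFrac

/-! ### Second differences and local Hölder bounds -/

variable {n : ℕ} {F : Type} [NormedAddCommGroup F]

/-- The symmetric second difference `2 v(x) - v(x+z) - v(x-z)`. -/
def secondDiff (v : Rn n → F) (x z : Rn n) : F := (v x - v (x + z)) + (v x - v (x - z))

/-- `‖2 v(x) - v(x+z) - v(x-z)‖ ≤ C ‖z‖^β` for `‖z‖ ≤ 1`, locally uniformly in `x`. -/
def SecondDiffBound (β : ℝ) (v : Rn n → F) : Prop :=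
  ∀ R : ℝ, ∃ C : ℝ, 0 ≤ C ∧ ∀ x z : Rn n, ‖x‖ ≤ R → ‖z‖ ≤ 1 → ‖secondDiff v x z‖ ≤ C * ‖z‖ ^ β

/-- `v` is `γ`-Hölder on every ball. -/
def HolderOnBalls (γ : ℝ) (v : Rn n → F) : Prop :=
  ∀ R : ℝ, ∃ C : ℝ, 0 ≤ C ∧ ∀ x y : Rn n, ‖x‖ ≤ R → ‖y‖ ≤ R → ‖v x - v y‖ ≤ C * ‖x - y‖ ^ γ

theorem continuous_secondDiff {v : Rn n → F} (hv : Continuous v) :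
    Continuous fun p : Rn n × Rn n => secondDiff v p.1 p.2 := by
  unfold secondDiff; fun_prop

theorem HolderOnBalls.secondDiffBound {γ : ℝ} {v : Rn n → F} (hv : HolderOnBalls γ v) :
    SecondDiffBound γ v := by
  intro R
  obtain ⟨C, hC, h⟩ := hv (R + 1)
  refine ⟨C + C, by positivity, fun x z hx hz => ?_⟩
  have h1 := h x (x + z) (by linarith) ((norm_add_le _ _).trans (by linarith))
  have h2 := h x (x - z) (by linarith) ((norm_sub_le _ _).trans (by linarith))
  rw [sub_add_cancel_left, norm_neg] at h1
  rw [sub_sub_cancel] at h2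
  exact (norm_add_le _ _).trans (by linarith)

variable [NormedSpace ℝ F]

theorem norm_iteratedFDeriv_zero_sub (v : Rn n → F) (x y : Rn n) :
    ‖iteratedFDeriv ℝ 0 v x - iteratedFDeriv ℝ 0 v y‖ = ‖v x - v y‖ := by
  simp only [iteratedFDeriv_zero_eq_comp, Function.comp_apply, ← dist_eq_norm]
  exact LinearIsometryEquiv.dist_map _ _ _

theorem norm_iteratedFDeriv_succ_sub (k : ℕ) (v : Rn n → F) (x y : Rn n) :
    ‖iteratedFDeriv ℝ (k + 1) v x - iteratedFDeriv ℝ (k + 1) v y‖ =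
      ‖iteratedFDeriv ℝ k (fderiv ℝ v) x - iteratedFDeriv ℝ k (fderiv ℝ v) y‖ := by
  simp only [iteratedFDeriv_succ_eq_comp_right, Function.comp_apply, ← dist_eq_norm]
  exact LinearIsometryEquiv.dist_map _ _ _

theorem hasFDerivAt_secondDiff {v : Rn n → F} (hv : Differentiable ℝ v) (x z : Rn n) :
    HasFDerivAt (fun x => secondDiff v x z) (secondDiff (fderiv ℝ v) x z) x := by
  have h0 := (hv x).hasFDerivAt
  have h1 : HasFDerivAt (fun x => v (x + z)) (fderiv ℝ v (x + z)) x := 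
    (hasFDerivAt_comp_add_right z).2 (hv (x + z)).hasFDerivAt
  have h2 : HasFDerivAt (fun x => v (x - z)) (fderiv ℝ v (x - z)) x := 
    (hasFDerivAt_comp_sub z).2 (hv (x - z)).hasFDerivAt
  exact (h0.sub h1).add (h0.sub h2)

/-- The second difference is the increment of y ↦ v(y+z) - v(y) from x to x - z. The mean value
inequality yields one factor ‖z‖, and the Hölder bound on the derivative yields ‖z‖^γ. -/
theorem HolderOnBalls.secondDiffBound_of_fderiv {γ : ℝ} (hγ : 0 ≤ γ) {v : Rn n → F}
    (hv : Differentiable ℝ v) (h : HolderOnBalls γ (fderiv ℝ v)) :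
    SecondDiffBound (1 + γ) v := by
  intro R
  obtain ⟨C, hC, h⟩ := h (R + 2)
  -- The factor `2 ^ γ` is slack: the argument below already gives the constant C.
  refine ⟨C * 2 ^ γ, by positivity, fun x z hx hz => ?_⟩
  rcases eq_or_ne z 0 with rfl | hz0
  · simp only [secondDiff, add_zero, sub_zero, sub_self, norm_zero]
    positivity
  -- mean value inequality along the segment from `x - z` to `x`
  set g : Rn n → F := fun y => v (y + z) - v y
  have hg : ∀ y, HasFDerivAt g (fderiv ℝ v (y + z) - fderiv ℝ v y) y := fun y => by
    have h1 : HasFDerivAt (fun x => v (x + z)) (fderiv ℝ v (y + z)) y := 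
    (hasFDerivAt_comp_add_right z).2 (hv (y + z)).hasFDerivAt
    exact h1.sub (hv y).hasFDerivAt
  have hb : ∀ y ∈ Metric.closedBall x ‖z‖, ‖fderiv ℝ v (y + z) - fderiv ℝ v y‖ ≤ C * ‖z‖ ^ γ := by
    intro y hy
    have hy' : ‖y‖ ≤ R + 1 := by
      have := norm_le_norm_add_norm_sub x y
      rw [mem_closedBall_iff_norm, norm_sub_rev] at hy
      linarith
    simpa using h (y + z) y ((norm_add_le _ _).trans (by linarith)) (by linarith)
  have key := (convex_closedBall x ‖z‖).norm_image_sub_le_of_norm_hasFDerivWithin_le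
    (f := g) (fun y _ => (hg y).hasFDerivWithinAt) hb (x := x) (y := x - z)
    (Metric.mem_closedBall_self (norm_nonneg _)) (by simp)
  have e : secondDiff v x z = g (x - z) - g x := by
    simp only [secondDiff, g, sub_add_cancel]; abel
  rw [e]
  refine key.trans ?_
  rw [sub_sub_cancel_left, norm_neg, Real.rpow_add (norm_pos_iff.2 hz0), Real.rpow_one]
  have : (1 : ℝ) ≤ 2 ^ γ := Real.one_le_rpow (by norm_num) hγ
  have h0 : 0 ≤ C * (‖z‖ * ‖z‖ ^ γ) := by positivity
  nlinarith

theorem holderOnBalls_of_contDiff_one {γ : ℝ} (hγ : γ ≤ 1) {v : Rn n → F}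
    (hv : ContDiff ℝ 1 v) : HolderOnBalls γ v := by
  intro R
  have hc : IsCompact (Metric.closedBall (0 : Rn n) R) := isCompact_closedBall _ _
  obtain ⟨C, hC⟩ := hc.exists_bound_of_continuousOn
    (hv.continuous_fderiv one_ne_zero).continuousOn
  -- One factor ‖x - y‖^(1-γ) of the Lipschitz bound is absorbed into the diameter; the absolute
  -- values cover an empty ball, where R and C may be negative.
  refine ⟨|C| * (2 * |R| + 1) ^ (1 - γ), by positivity, fun x y hx hy => ?_⟩
  have key := (convex_closedBall (0 : Rn n) R).norm_image_sub_le_of_norm_fderiv_le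
    (fun z _ => (hv.differentiable one_ne_zero) z) hC (x := y) (y := x)
    (by simpa using hy) (by simpa using hx)
  have hxy : ‖x - y‖ ≤ 2 * |R| + 1 := by
    have := norm_sub_le x y
    have := le_abs_self R
    linarith
  have : ‖x - y‖ ≤ (2 * |R| + 1) ^ (1 - γ) * ‖x - y‖ ^ γ := by
    rcases (norm_nonneg (x - y)).eq_or_lt with h0 | h0
    · rw [← h0]; positivity
    calc ‖x - y‖ = ‖x - y‖ ^ (1 - γ) * ‖x - y‖ ^ γ := by
          rw [← Real.rpow_add h0]; simp
      _ ≤ _ := by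
          gcongr
  calc ‖v x - v y‖ ≤ C * ‖x - y‖ := key
    _ ≤ |C| * ‖x - y‖ := by gcongr; exact le_abs_self C
    _ ≤ |C| * ((2 * |R| + 1) ^ (1 - γ) * ‖x - y‖ ^ γ) := by gcongr
    _ = _ := by ring

/-- A `C^{k+a}` function whose top derivative is locally `γ`-Hölder satisfies the second difference
bound of order `a + γ`. -/
theorem secondDiffBound_of_contDiff {a : ℕ} (ha : a ≤ 1) {γ : ℝ} (hγ0 : 0 ≤ γ) (hγ : γ ≤ 1)
    (k : ℕ) {v : Rn n → F} (hv : ContDiff ℝ ((k + a : ℕ) : WithTop ℕ∞) v)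
    (hh : HolderOnBalls γ (iteratedFDeriv ℝ (k + a) v)) : SecondDiffBound (a + γ) v := by
  rcases k with _ | k
  · interval_cases a
    · have : HolderOnBalls γ v := fun R => by
        obtain ⟨C, hC, h⟩ := hh R
        refine ⟨C, hC, fun x y hx hy => ?_⟩
        simpa only [Nat.add_zero, norm_iteratedFDeriv_zero_sub] using h x y hx hy
      simpa using this.secondDiffBound
    · have h1 : HolderOnBalls γ (fderiv ℝ v) := fun R => by
        obtain ⟨C, hC, h⟩ := hh R
        refine ⟨C, hC, fun x y hx hy => ?_⟩
        simpa only [norm_iteratedFDeriv_succ_sub, norm_iteratedFDeriv_zero_sub] using h x y hx hy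
      have := h1.secondDiffBound_of_fderiv hγ0 (hv.differentiable (by simp))
      simpa using this
  -- A spare derivative remains here, so v (for a = 0) or its derivative (for a = 1) is C¹ and hence
  -- γ-Hölder on balls.
  · interval_cases a
    · have : HolderOnBalls γ v := holderOnBalls_of_contDiff_one hγ (hv.of_le (by
        norm_cast; omega))
      simpa using this.secondDiffBound
    · have h2 : ContDiff ℝ 1 (fderiv ℝ v) := hv.fderiv_right (by norm_cast; omega)
      have := (holderOnBalls_of_contDiff_one hγ h2).secondDiffBound_of_fderiv hγ0
        (hv.differentiable (by simp))
      simpa using this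

/-! ### Second-difference operators with kernel supported in the unit ball -/

/-- The operator `v ↦ ∫ κ(z) (2 v(x) - v(x+z) - v(x-z)) dz`. -/
def diffOp (κ : Rn n → ℝ) (v : Rn n → F) (x : Rn n) : F := ∫ z, κ z • secondDiff v x z

theorem norm_smul_secondDiff_le {κ : Rn n → ℝ} {β C : ℝ} {v : Rn n → F} {x z : Rn n}
    (hκ : 1 < ‖z‖ → κ z = 0) (h : ‖z‖ ≤ 1 → ‖secondDiff v x z‖ ≤ C * ‖z‖ ^ β) :
    ‖κ z • secondDiff v x z‖ ≤ C * (|κ z| * ‖z‖ ^ β) := by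
  rw [norm_smul, Real.norm_eq_abs]
  by_cases hz : ‖z‖ ≤ 1
  · calc |κ z| * ‖secondDiff v x z‖ ≤ |κ z| * (C * ‖z‖ ^ β) := by gcongr; exact h hz
      _ = _ := by ring
  · rw [hκ (not_le.1 hz)]; simp

theorem continuous_diffOp {κ : Rn n → ℝ} {β : ℝ} (hm : AEStronglyMeasurable κ)
    (hκ : ∀ z, 1 < ‖z‖ → κ z = 0) (hi : Integrable fun z => |κ z| * ‖z‖ ^ β)
    {v : Rn n → F} (hv : Continuous v) (hb : SecondDiffBound β v) :
    Continuous (diffOp κ v) := by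
  refine continuous_iff_continuousAt.2 fun x₀ => ?_
  obtain ⟨C, hC, h⟩ := hb (‖x₀‖ + 1)
  have hmem : Metric.ball x₀ 1 ∈ 𝓝 x₀ := Metric.ball_mem_nhds _ one_pos
  refine continuousAt_of_dominated (bound := fun z => C * (|κ z| * ‖z‖ ^ β))
    (Eventually.of_forall fun x => ?_) ?_ (hi.const_mul C) (Eventually.of_forall fun z => ?_)
  · exact hm.smul ((continuous_secondDiff hv).comp (by fun_prop :
      Continuous fun z => (x, z))).aestronglyMeasurable
  · filter_upwards [hmem] with x hx
    refine Eventually.of_forall fun z => norm_smul_secondDiff_le (hκ z) (h x z ?_)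
    rw [mem_ball_iff_norm] at hx
    have := norm_le_norm_add_norm_sub' x x₀
    linarith
  · exact ((continuous_secondDiff hv).comp (by fun_prop :
      Continuous fun x => (x, z))).continuousAt.const_smul _

theorem hasFDerivAt_diffOp {κ : Rn n → ℝ} {β : ℝ} (hm : AEStronglyMeasurable κ)
    (hκ : ∀ z, 1 < ‖z‖ → κ z = 0) (hi : Integrable fun z => |κ z| * ‖z‖ ^ β)
    {v : Rn n → F} (hv : ContDiff ℝ 1 v) (hb : SecondDiffBound β v)
    (hb' : SecondDiffBound β (fderiv ℝ v)) (x₀ : Rn n) :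
    HasFDerivAt (diffOp κ v) (diffOp κ (fderiv ℝ v) x₀) x₀ := by
  obtain ⟨C, hC, h⟩ := hb ‖x₀‖
  obtain ⟨C', hC', h'⟩ := hb' (‖x₀‖ + 1)
  have hvc := hv.continuous
  have hvc' := hv.continuous_fderiv one_ne_zero
  refine hasFDerivAt_integral_of_dominated_of_fderiv_le (s := Metric.ball x₀ 1)
    (bound := fun z => C' * (|κ z| * ‖z‖ ^ β))
    (F' := fun x z => κ z • secondDiff (fderiv ℝ v) x z)
    (Metric.ball_mem_nhds _ one_pos) (Eventually.of_forall fun x => ?_) ?_ ?_ ?_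
    (hi.const_mul C') (Eventually.of_forall fun z x _ => ?_)
  · exact hm.smul ((continuous_secondDiff hvc).comp (by fun_prop :
      Continuous fun z => (x, z))).aestronglyMeasurable
  · refine (hi.const_mul C).mono' (hm.smul ((continuous_secondDiff hvc).comp (by fun_prop :
      Continuous fun z => (x₀, z))).aestronglyMeasurable) (Eventually.of_forall fun z => ?_)
    exact norm_smul_secondDiff_le (hκ z) (h x₀ z le_rfl)
  · exact hm.smul ((continuous_secondDiff hvc').comp (by fun_prop :
      Continuous fun z => (x₀, z))).aestronglyMeasurable
  · refine Eventually.of_forall fun z x hx => norm_smul_secondDiff_le (hκ z) (h' x z ?_)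
    rw [mem_ball_iff_norm] at hx
    have := norm_le_norm_add_norm_sub' x x₀
    linarith
  · exact (hasFDerivAt_secondDiff (hv.differentiable one_ne_zero) x z).const_smul (κ z)

/-- The operator commutes with differentiation, so each inductive step replaces v by `fderiv ℝ v`.
This changes the target space, which is why F is quantified inside the induction. -/
theorem contDiff_diffOp {κ : Rn n → ℝ} {a : ℕ} (ha : a ≤ 1) {γ : ℝ} (hγ0 : 0 ≤ γ) (hγ : γ ≤ 1)
    (hm : AEStronglyMeasurable κ) (hκ : ∀ z, 1 < ‖z‖ → κ z = 0)
    (hi : Integrable fun z => |κ z| * ‖z‖ ^ (a + γ)) (k : ℕ) :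
    ∀ {F : Type} [NormedAddCommGroup F] [NormedSpace ℝ F] {v : Rn n → F},
      ContDiff ℝ ((k + a : ℕ) : WithTop ℕ∞) v → HolderOnBalls γ (iteratedFDeriv ℝ (k + a) v) →
      ContDiff ℝ (k : WithTop ℕ∞) (diffOp κ v) := by
  induction k with
  | zero =>
    intro F _ _ v hv hh
    exact contDiff_zero.2 (continuous_diffOp hm hκ hi hv.continuous
      (secondDiffBound_of_contDiff ha hγ0 hγ 0 hv hh))
  | succ k ih =>
    intro F _ _ v hv hh
    have hv' : ContDiff ℝ ((k + a : ℕ) : WithTop ℕ∞) (fderiv ℝ v) :=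
      hv.fderiv_right (by norm_cast; omega)
    have hh' : HolderOnBalls γ (iteratedFDeriv ℝ (k + a) (fderiv ℝ v)) := fun R => by
      obtain ⟨C, hC, h⟩ := hh R
      refine ⟨C, hC, fun x y hx hy => ?_⟩
      have := h x y hx hy
      rwa [show k + 1 + a = k + a + 1 by ring, norm_iteratedFDeriv_succ_sub] at this
    have hd := hasFDerivAt_diffOp hm hκ hi (hv.of_le (by norm_cast; omega))
      (secondDiffBound_of_contDiff ha hγ0 hγ (k + 1) hv hh)
      (secondDiffBound_of_contDiff ha hγ0 hγ k hv' hh')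
    rw [Nat.cast_succ, contDiff_succ_iff_hasFDerivAt]
    exact ⟨_, ih hv' hh', hd⟩

/-! ### Convolution with smooth decaying kernels -/

/-- A Peetre-type inequality, from 1 + ‖y‖ ≤ (1 + R)(1 + ‖x - y‖): translating by a bounded vector
costs the weight only a constant. -/
theorem one_add_norm_rpow_neg_le {s R : ℝ} (hs : 0 ≤ s) {x y : Rn n} (hx : ‖x‖ ≤ R) :
    (1 + ‖x - y‖) ^ (-s) ≤ (1 + R) ^ s * (1 + ‖y‖) ^ (-s) := by
  have hR : 0 ≤ R := (norm_nonneg x).trans hx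
  have h : 1 + ‖y‖ ≤ (1 + R) * (1 + ‖x - y‖) := by
    have h1 : ‖y‖ ≤ ‖x‖ + ‖x - y‖ := by
      have := norm_sub_le x (x - y); rwa [sub_sub_cancel] at this
    nlinarith [norm_nonneg (x - y)]
  have h2 : ((1 + R) * (1 + ‖x - y‖)) ^ (-s) ≤ (1 + ‖y‖) ^ (-s) :=
    Real.rpow_le_rpow_of_nonpos (by positivity) h (by linarith)
  rw [Real.mul_rpow (by positivity) (by positivity)] at h2
  calc (1 + ‖x - y‖) ^ (-s) = (1 + R) ^ s * ((1 + R) ^ (-s) * (1 + ‖x - y‖) ^ (-s)) := by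
        rw [← mul_assoc, ← Real.rpow_add (by positivity)]; simp
    _ ≤ _ := by gcongr

/-- Smooth kernels which are homogeneous of degree `-t` outside some ball. -/
def IsFarKernel (t : ℝ) (G : Rn n → F) : Prop :=
  ContDiff ℝ (⊤ : ℕ∞) G ∧ ∃ ρ : ℝ, 0 < ρ ∧
    ∀ (z : Rn n) (c : ℝ), ρ < ‖z‖ → 1 ≤ c → G (c • z) = c ^ (-t) • G z

theorem IsFarKernel.fderiv {t : ℝ} {G : Rn n → F} (hG : IsFarKernel t G) :
    IsFarKernel (t + 1) (fderiv ℝ G) := by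
  obtain ⟨hs, ρ, hρ, h⟩ := hG
  refine ⟨hs.fderiv_right (by simp), ρ, hρ, fun z c hz hc => ?_⟩
  have hc0 : 0 < c := by linarith
  -- The strict inequality ρ < ‖z‖ makes homogeneity an identity near z, so it can be
  -- differentiated.
  have he : (fun y => G (c • y)) =ᶠ[𝓝 z] fun y => c ^ (-t) • G y := by
    filter_upwards [continuous_norm.continuousAt.eventually_const_lt hz] with y hy
    exact h y c hy hc
  have h1 := he.fderiv_eq (𝕜 := ℝ)
  rw [fderiv_comp_smul, fderiv_fun_const_smul (hs.differentiable (by simp) z)] at h1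
  rw [show -(t + 1) = -1 + -t by ring, Real.rpow_add hc0, Real.rpow_neg_one, mul_smul, ← h1,
    smul_smul, inv_mul_cancel₀ hc0.ne', one_smul]

/-- Compactness bounds G on the ball of radius 2ρ, and homogeneity carries the bound on the sphere
outward. Allowing s ≤ t keeps one weight for G and all its derivatives. -/
theorem IsFarKernel.exists_norm_le {s t : ℝ} (hs : 0 ≤ s) (hst : s ≤ t) {G : Rn n → F}
    (hG : IsFarKernel t G) : ∃ C : ℝ, 0 ≤ C ∧ ∀ z, ‖G z‖ ≤ C * (1 + ‖z‖) ^ (-s) := by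
  obtain ⟨hsm, ρ, hρ, h⟩ := hG
  obtain ⟨M, hM⟩ := (isCompact_closedBall (0 : Rn n) (2 * ρ)).exists_bound_of_continuousOn
    hsm.continuous.continuousOn
  have hM0 : 0 ≤ M := (norm_nonneg _).trans (hM 0 (by simpa using hρ.le))
  -- Used with c = 1 inside the ball and with c = ‖z‖ / (2ρ) outside it.
  have aux : ∀ (z : Rn n) (c : ℝ), 1 ≤ c → ‖z‖ ≤ 2 * ρ * c →
      c ^ (-s) ≤ (1 + 2 * ρ) ^ s * (1 + ‖z‖) ^ (-s) := by
    intro z c hc hz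
    have h1 : 1 + ‖z‖ ≤ (1 + 2 * ρ) * c := by nlinarith
    have h2 : ((1 + 2 * ρ) * c) ^ (-s) ≤ (1 + ‖z‖) ^ (-s) :=
      Real.rpow_le_rpow_of_nonpos (by positivity) h1 (by linarith)
    rw [Real.mul_rpow (by positivity) (by positivity)] at h2
    calc c ^ (-s) = (1 + 2 * ρ) ^ s * ((1 + 2 * ρ) ^ (-s) * c ^ (-s)) := by
          rw [← mul_assoc, ← Real.rpow_add (by positivity)]; simp
      _ ≤ _ := by gcongr
  refine ⟨M * (1 + 2 * ρ) ^ s, by positivity, fun z => ?_⟩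
  rw [mul_assoc]
  by_cases hz : ‖z‖ ≤ 2 * ρ
  · have h1 := aux z 1 le_rfl (by simpa using hz)
    rw [Real.one_rpow] at h1
    calc ‖G z‖ ≤ M * 1 := by simpa using hM z (by simpa using hz)
      _ ≤ _ := by gcongr
  · push Not at hz
    set c := ‖z‖ / (2 * ρ)
    have hc : 1 ≤ c := by rw [one_le_div (by positivity)]; exact hz.le
    have hc0 : 0 < c := by linarith
    have hcz : ‖c⁻¹ • z‖ = 2 * ρ := by
      rw [norm_smul, norm_inv, Real.norm_of_nonneg hc0.le]
      have : ‖z‖ ≠ 0 := by linarith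
      simp only [c]; field_simp
    have h1 := h (c⁻¹ • z) c (by rw [hcz]; linarith) hc
    rw [smul_smul, mul_inv_cancel₀ hc0.ne', one_smul] at h1
    rw [h1, norm_smul, Real.norm_of_nonneg (by positivity)]
    have h2 := hM (c⁻¹ • z) (by simp only [mem_closedBall_zero_iff]; exact hcz.le)
    have h3 : c ^ (-t) ≤ c ^ (-s) := Real.rpow_le_rpow_of_exponent_le hc (by linarith)
    have h4 := aux z c hc (by simp only [c]; field_simp; exact le_rfl)
    calc c ^ (-t) * ‖G (c⁻¹ • z)‖ ≤ ((1 + 2 * ρ) ^ s * (1 + ‖z‖) ^ (-s)) * M := by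
          gcongr; exact h3.trans h4
      _ = _ := by ring

/-- The convolution of `u` with the kernel `G`. -/
def farOp (u : Rn n → ℝ) (G : Rn n → F) (x : Rn n) : F := ∫ y, u y • G (x - y)

theorem norm_smul_farKernel_le {s C R : ℝ} (hs : 0 ≤ s) (hC : 0 ≤ C) {G : Rn n → F}
    (h : ∀ z, ‖G z‖ ≤ C * (1 + ‖z‖) ^ (-s)) (u : Rn n → ℝ) {x : Rn n} (hx : ‖x‖ ≤ R) (y : Rn n) :
    ‖u y • G (x - y)‖ ≤ C * (1 + R) ^ s * (|u y| * (1 + ‖y‖) ^ (-s)) := by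
  rw [norm_smul, Real.norm_eq_abs]
  calc |u y| * ‖G (x - y)‖ ≤ |u y| * (C * ((1 + R) ^ s * (1 + ‖y‖) ^ (-s))) := by
        gcongr
        refine (h _).trans ?_
        gcongr
        exact one_add_norm_rpow_neg_le hs hx
    _ = _ := by ring

theorem integrable_smul_farKernel {s t : ℝ} (hs : 0 ≤ s) (hst : s ≤ t) {u : Rn n → ℝ}
    (hu : AEStronglyMeasurable u) (hi : Integrable fun y => |u y| * (1 + ‖y‖) ^ (-s))
    {G : Rn n → F} (hG : IsFarKernel t G) (x : Rn n) :
    Integrable fun y => u y • G (x - y) := by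
  obtain ⟨C, hC, h⟩ := hG.exists_norm_le hs hst
  have hGc := hG.1.continuous
  exact (hi.const_mul (C * (1 + ‖x‖) ^ s)).mono' (hu.smul (by fun_prop :
    Continuous fun y => G (x - y)).aestronglyMeasurable)
    (Eventually.of_forall (norm_smul_farKernel_le hs hC h u le_rfl))

theorem hasFDerivAt_farOp {s t : ℝ} (hs : 0 ≤ s) (hst : s ≤ t) {u : Rn n → ℝ}
    (hu : AEStronglyMeasurable u) (hi : Integrable fun y => |u y| * (1 + ‖y‖) ^ (-s))
    {G : Rn n → F} (hG : IsFarKernel t G) (x₀ : Rn n) :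
    HasFDerivAt (farOp u G) (farOp u (fderiv ℝ G) x₀) x₀ := by
  obtain ⟨C, hC, h⟩ := hG.fderiv.exists_norm_le hs (by linarith)
  have hGc := hG.1.continuous
  have hGc' := hG.fderiv.1.continuous
  refine hasFDerivAt_integral_of_dominated_of_fderiv_le (s := Metric.ball x₀ 1)
    (bound := fun y => C * (1 + (‖x₀‖ + 1)) ^ s * (|u y| * (1 + ‖y‖) ^ (-s)))
    (F' := fun x y => u y • fderiv ℝ G (x - y))
    (Metric.ball_mem_nhds _ one_pos) (Eventually.of_forall fun x => ?_)
    (integrable_smul_farKernel hs hst hu hi hG x₀) ?_ ?_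
    (hi.const_mul _) (Eventually.of_forall fun y x _ => ?_)
  · exact hu.smul (by fun_prop : Continuous fun y => G (x - y)).aestronglyMeasurable
  · exact hu.smul (by fun_prop : Continuous fun y => fderiv ℝ G (x₀ - y)).aestronglyMeasurable
  · refine Eventually.of_forall fun y x hx => norm_smul_farKernel_le hs hC h u ?_ y
    rw [mem_ball_iff_norm] at hx
    have := norm_le_norm_add_norm_sub' x x₀
    linarith
  · exact ((hasFDerivAt_comp_sub y).2
      (hG.1.differentiable (by simp) (x - y)).hasFDerivAt).const_smul (u y)

/-- All derivatives fall on G, whose decay only improves, so the one weight of order s dominates at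
every stage. -/
theorem contDiff_farOp {s : ℝ} (hs : 0 ≤ s) {u : Rn n → ℝ}
    (hu : AEStronglyMeasurable u) (hi : Integrable fun y => |u y| * (1 + ‖y‖) ^ (-s)) (k : ℕ) :
    ∀ {F : Type} [NormedAddCommGroup F] [NormedSpace ℝ F] {t : ℝ} {G : Rn n → F}, s ≤ t →
      IsFarKernel t G → ContDiff ℝ (k : WithTop ℕ∞) (farOp u G) := by
  induction k with
  | zero =>
    intro F _ _ t G hst hG
    exact contDiff_zero.2 (continuous_iff_continuousAt.2 fun x =>
      (hasFDerivAt_farOp hs hst hu hi hG x).continuousAt)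
  | succ k ih =>
    intro F _ _ t G hst hG
    rw [Nat.cast_succ, contDiff_succ_iff_hasFDerivAt]
    exact ⟨_, ih (by linarith) hG.fderiv, hasFDerivAt_farOp hs hst hu hi hG⟩

/-! ### Splitting the kernel ‖z‖^(-s) -/

/-- A smooth cutoff equal to `1` near the origin and supported in the unit ball. -/
def kernelBump (n : ℕ) : ContDiffBump (0 : Rn n) := ⟨1 / 2, 1, by norm_num, by norm_num⟩

/-- The part of `‖z‖^{-s}` near the origin. -/
def nearKernel (s : ℝ) (z : Rn n) : ℝ := kernelBump n z * ‖z‖ ^ (-s)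

/-- The part of `‖z‖^{-s}` away from the origin. -/
def farKernel (s : ℝ) (z : Rn n) : ℝ := (1 - kernelBump n z) * ‖z‖ ^ (-s)

theorem nearKernel_add_farKernel (s : ℝ) (z : Rn n) :
    nearKernel s z + farKernel s z = ‖z‖ ^ (-s) := by
  unfold nearKernel farKernel; ring

theorem farKernel_neg (s : ℝ) (z : Rn n) : farKernel s (-z) = farKernel s z := by
  simp only [farKernel, norm_neg, (kernelBump n).neg]

/-- The cutoff equals 1 near the origin, which removes the singularity, and 0 beyond norm one, which
leaves the pure power. -/
theorem isFarKernel_farKernel (s : ℝ) : IsFarKernel s (farKernel (n := n) s) := by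
  refine ⟨contDiff_iff_contDiffAt.2 fun z => ?_, 1, one_pos, fun z c hz hc => ?_⟩
  · rcases eq_or_ne z 0 with rfl | hz
    · refine (contDiffAt_const (c := (0 : ℝ))).congr_of_eventuallyEq ?_
      filter_upwards [(kernelBump n).eventuallyEq_one] with y hy
      simp only [farKernel, hy, Pi.one_apply, sub_self, zero_mul]
    · exact (contDiffAt_const.sub (kernelBump n).contDiffAt).mul
        ((contDiffAt_norm ℝ hz).rpow_const_of_ne (norm_ne_zero_iff.2 hz))
  · have h0 : ∀ y : Rn n, 1 ≤ ‖y‖ → kernelBump n y = 0 := fun y hy =>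
      (kernelBump n).zero_of_le_dist (by simpa [kernelBump] using hy)
    have hc0 : 0 ≤ c := by linarith
    have hcz : 1 ≤ ‖c • z‖ := by
      rw [norm_smul, Real.norm_of_nonneg hc0]; nlinarith
    simp only [farKernel, h0 z hz.le, h0 _ hcz, norm_smul, Real.norm_of_nonneg hc0,
      Real.mul_rpow hc0 (norm_nonneg z), smul_eq_mul]
    ring

theorem nearKernel_eq_zero (s : ℝ) {z : Rn n} (hz : 1 < ‖z‖) : nearKernel s z = 0 := by
  rw [nearKernel, (kernelBump n).zero_of_le_dist (by simpa [kernelBump] using hz.le), zero_mul]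

theorem nearKernel_nonneg (s : ℝ) (z : Rn n) : 0 ≤ nearKernel s z :=
  mul_nonneg (kernelBump n).nonneg (by positivity)

theorem nearKernel_le (s : ℝ) (z : Rn n) : nearKernel s z ≤ ‖z‖ ^ (-s) :=
  mul_le_of_le_one_left (by positivity) (kernelBump n).le_one

theorem measurable_norm_rpow (s : ℝ) : Measurable fun z : Rn n => ‖z‖ ^ s :=
  measurable_norm.pow_const s

theorem measurable_nearKernel (s : ℝ) : Measurable (nearKernel (n := n) s) :=
  (kernelBump n).continuous.measurable.mul (measurable_norm_rpow _)

theorem integrableOn_norm_rpow_mul (hn : 1 ≤ n) {s β : ℝ} (h : s < n + β) (r : ℝ) :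
    IntegrableOn (fun z : Rn n => ‖z‖ ^ (-s) * ‖z‖ ^ β) (Metric.ball 0 r) := by
  have : Nonempty (Fin n) := ⟨⟨0, hn⟩⟩
  refine integrableOn_ball_of_norm_le_rpow (by simpa using hn) (α := s - β) (C := 1) ?_ ?_
    ((measurable_norm_rpow _).mul (measurable_norm_rpow _)).aestronglyMeasurable
  · simp only [finrank_euclideanSpace, Fintype.card_fin]; linarith
  · refine ae_restrict_of_ae ?_
    -- The exponents are added only away from the origin, a null set.
    filter_upwards [compl_mem_ae_iff.2 (measure_singleton (0 : Rn n))] with z hz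
    rw [Real.norm_of_nonneg (by positivity), one_mul,
      ← Real.rpow_add (norm_pos_iff.2 hz), neg_sub, sub_eq_neg_add]

theorem integrable_nearKernel (hn : 1 ≤ n) {s β : ℝ} (h : s < n + β) :
    Integrable fun z : Rn n => |nearKernel s z| * ‖z‖ ^ β := by
  refine (integrableOn_iff_integrable_of_support_subset (s := Metric.ball 0 2) fun z hz => ?_).1
    ((integrableOn_norm_rpow_mul hn h 2).mono'
      ((continuous_abs.measurable.comp (measurable_nearKernel s)).mul
        (measurable_norm_rpow _)).aestronglyMeasurable (Eventually.of_forall fun z => ?_))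
  · by_contra hz'
    refine hz ?_
    have : 1 < ‖z‖ := by
      rw [mem_ball_zero_iff, not_lt] at hz'; linarith
    simp [nearKernel_eq_zero s this]
  · rw [Real.norm_of_nonneg (by positivity), abs_of_nonneg (nearKernel_nonneg s z)]
    gcongr
    exact nearKernel_le s z

theorem farKernel_nonneg (s : ℝ) (z : Rn n) : 0 ≤ farKernel s z :=
  mul_nonneg (sub_nonneg.2 (kernelBump n).le_one) (by positivity)

theorem integrable_one_add_norm_rpow_neg {s : ℝ} (hs : (n : ℝ) < s) :
    Integrable fun z : Rn n => (1 + ‖z‖) ^ (-s) :=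
  integrable_one_add_norm (by simpa using hs)

theorem integrable_farKernel {s : ℝ} (hs : (n : ℝ) < s) : Integrable (farKernel (n := n) s) := by
  obtain ⟨C, hC, h⟩ := (isFarKernel_farKernel (n := n) s).exists_norm_le
    (n.cast_nonneg.trans hs.le) le_rfl
  exact ((integrable_one_add_norm_rpow_neg hs).const_mul C).mono'
    (isFarKernel_farKernel s).1.continuous.aestronglyMeasurable (Eventually.of_forall h)

section Far

variable {s : ℝ} {u : Rn n → ℝ}

theorem integrable_farKernel_mul_sub (hs : 0 ≤ s) (hu : AEStronglyMeasurable u)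
    (hi : Integrable fun y => |u y| * (1 + ‖y‖) ^ (-s)) (x : Rn n) :
    Integrable fun z => farKernel s z * u (x - z) := by
  have := (integrable_smul_farKernel hs le_rfl hu hi (isFarKernel_farKernel s) x).comp_sub_left x
  simpa only [sub_sub_cancel, smul_eq_mul, mul_comm] using this

theorem integrable_farKernel_mul_add (hs : 0 ≤ s) (hu : AEStronglyMeasurable u)
    (hi : Integrable fun y => |u y| * (1 + ‖y‖) ^ (-s)) (x : Rn n) :
    Integrable fun z => farKernel s z * u (x + z) := by
  simpa only [farKernel_neg, sub_neg_eq_add] using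
    (integrable_farKernel_mul_sub hs hu hi x).comp_neg

theorem integral_farKernel_mul_sub (s : ℝ) (u : Rn n → ℝ) (x : Rn n) :
    ∫ z, farKernel s z * u (x - z) = farOp u (farKernel s) x := by
  rw [farOp, ← integral_sub_left_eq_self _ volume x]
  simp only [sub_sub_cancel, smul_eq_mul, mul_comm]

theorem integral_farKernel_mul_add (s : ℝ) (u : Rn n → ℝ) (x : Rn n) :
    ∫ z, farKernel s z * u (x + z) = farOp u (farKernel s) x := by
  rw [← integral_farKernel_mul_sub, ← integral_neg_eq_self]
  simp only [farKernel_neg, ← sub_eq_add_neg]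

theorem integrable_farKernel_mul_secondDiff (hs : (n : ℝ) < s) (hu : AEStronglyMeasurable u)
    (hi : Integrable fun y => |u y| * (1 + ‖y‖) ^ (-s)) (x : Rn n) :
    Integrable fun z => farKernel s z * secondDiff u x z := by
  have hs0 : 0 ≤ s := n.cast_nonneg.trans hs.le
  have h := ((((integrable_farKernel hs).mul_const (u x)).sub
    (integrable_farKernel_mul_add hs0 hu hi x)).add
    (((integrable_farKernel hs).mul_const (u x)).sub (integrable_farKernel_mul_sub hs0 hu hi x)))
  refine h.congr (Eventually.of_forall fun z => ?_)
  simp only [Pi.add_apply, Pi.sub_apply, secondDiff]; ring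

/-- Since s > n the far kernel is integrable, so the terms separate; since it is even, both
translates give the same convolution. -/
theorem integral_farKernel_mul_secondDiff (hs : (n : ℝ) < s) (hu : AEStronglyMeasurable u)
    (hi : Integrable fun y => |u y| * (1 + ‖y‖) ^ (-s)) (x : Rn n) :
    ∫ z, farKernel s z * secondDiff u x z =
      2 * (∫ z : Rn n, farKernel s z) * u x - 2 * farOp u (farKernel s) x := by
  have hs0 : 0 ≤ s := n.cast_nonneg.trans hs.le
  have h1 := (integrable_farKernel (n := n) hs).mul_const (u x)
  have h2 := integrable_farKernel_mul_add hs0 hu hi x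
  have h3 := integrable_farKernel_mul_sub hs0 hu hi x
  have e : ∀ z, farKernel s z * secondDiff u x z =
      (farKernel s z * u x - farKernel s z * u (x + z)) +
        (farKernel s z * u x - farKernel s z * u (x - z)) := fun z => by
    simp only [secondDiff]; ring
  simp only [e]
  refine (integral_add (h1.sub h2) (h1.sub h3)).trans ?_
  simp only [Pi.sub_apply]
  rw [integral_sub h1 h2, integral_sub h1 h3,
    integral_farKernel_mul_add, integral_farKernel_mul_sub, integral_mul_const]
  ring

theorem integral_farKernel_mul_abs_secondDiff_le (hs : (n : ℝ) < s) (hu : AEStronglyMeasurable u)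
    (hi : Integrable fun y => |u y| * (1 + ‖y‖) ^ (-s)) (x : Rn n) :
    ∫ z, farKernel s z * |secondDiff u x z| ≤
      2 * (∫ z : Rn n, farKernel s z) * |u x| + 2 * farOp (fun y => |u y|) (farKernel s) x := by
  have hs0 : 0 ≤ s := n.cast_nonneg.trans hs.le
  have hu' : AEStronglyMeasurable fun y => |u y| := hu.norm
  have hi' : Integrable fun y => |(|u y|)| * (1 + ‖y‖) ^ (-s) := by simpa only [abs_abs] using hi
  have h1 := (integrable_farKernel (n := n) hs).mul_const |u x|
  have h2 := integrable_farKernel_mul_add hs0 hu' hi' x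
  have h3 := integrable_farKernel_mul_sub hs0 hu' hi' x
  calc ∫ z, farKernel s z * |secondDiff u x z|
      ≤ ∫ z, ((farKernel s z * |u x| + farKernel s z * |u (x + z)|) +
        (farKernel s z * |u x| + farKernel s z * |u (x - z)|)) := by
        refine integral_mono_of_nonneg (Eventually.of_forall fun z =>
          mul_nonneg (farKernel_nonneg s z) (abs_nonneg _)) ((h1.add h2).add (h1.add h3))
          (Eventually.of_forall fun z => ?_)
        have e : farKernel s z * |u x| + farKernel s z * |u (x + z)| +
            (farKernel s z * |u x| + farKernel s z * |u (x - z)|) =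
            farKernel s z * ((|u x| + |u (x + z)|) + (|u x| + |u (x - z)|)) := by ring
        simp only [e]
        refine mul_le_mul_of_nonneg_left ?_ (farKernel_nonneg s z)
        exact (abs_add_le _ _).trans (add_le_add (abs_sub _ _) (abs_sub _ _))
    _ = _ := by
        refine (integral_add (h1.add h2) (h1.add h3)).trans ?_
        simp only [Pi.add_apply]
        rw [integral_add h1 h2, integral_add h1 h3, integral_mul_const,
          integral_farKernel_mul_add s (fun y => |u y|), integral_farKernel_mul_sub s (fun y => |u y|)]
        ring

end Far

/-! ### The singular integral: convergence and regularity -/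

/-- The singular integral `∫ ‖z‖^{-s} (2 u(x) - u(x+z) - u(x-z)) dz`. -/
def singularIntegral (s : ℝ) (u : Rn n → ℝ) (x : Rn n) : ℝ :=
  ∫ z, ‖z‖ ^ (-s) * secondDiff u x z

/-- The data under which the singular integral of order `s` converges absolutely. -/
structure IsAdmissible (s β : ℝ) (u : Rn n → ℝ) : Prop where
  dim_pos : 1 ≤ n
  dim_lt : (n : ℝ) < s
  lt_add : s < n + β
  cont : Continuous u
  weighted : Integrable fun y => |u y| * (1 + ‖y‖) ^ (-s)
  bound : SecondDiffBound β u

namespace IsAdmissible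

variable {s β : ℝ} {u : Rn n → ℝ}

theorem pos (h : IsAdmissible s β u) : 0 < s := n.cast_nonneg.trans_lt h.dim_lt

theorem measurable_secondDiff (h : IsAdmissible s β u) (x : Rn n) :
    AEStronglyMeasurable fun z => secondDiff u x z :=
  ((continuous_secondDiff h.cont).comp (by fun_prop :
    Continuous fun z => (x, z))).aestronglyMeasurable

theorem norm_near_le (s : ℝ) {C : ℝ} {x z : Rn n}
    (hC : ‖z‖ ≤ 1 → ‖secondDiff u x z‖ ≤ C * ‖z‖ ^ β) :
    ‖nearKernel s z * secondDiff u x z‖ ≤ C * (|nearKernel s z| * ‖z‖ ^ β) :=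
  norm_smul_secondDiff_le (κ := nearKernel s) (fun hz => nearKernel_eq_zero s hz) hC

theorem integrable_near (h : IsAdmissible s β u) (x : Rn n) :
    Integrable fun z => nearKernel s z * secondDiff u x z := by
  obtain ⟨C, -, hb⟩ := h.bound ‖x‖
  exact ((integrable_nearKernel h.dim_pos h.lt_add).const_mul C).mono'
    ((measurable_nearKernel s).aestronglyMeasurable.mul (h.measurable_secondDiff x))
    (Eventually.of_forall fun z => norm_near_le s (hb x z le_rfl))

theorem integrable_far (h : IsAdmissible s β u) (x : Rn n) :
    Integrable fun z => farKernel s z * secondDiff u x z :=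
  integrable_farKernel_mul_secondDiff h.dim_lt h.cont.aestronglyMeasurable h.weighted x

theorem integrable (h : IsAdmissible s β u) (x : Rn n) :
    Integrable fun z => ‖z‖ ^ (-s) * secondDiff u x z := by
  simpa only [Pi.add_def, ← add_mul, nearKernel_add_farKernel] using
    (h.integrable_near x).add (h.integrable_far x)

theorem singularIntegral_eq (h : IsAdmissible s β u) (x : Rn n) :
    singularIntegral s u x = diffOp (nearKernel s) u x +
      (2 * (∫ z : Rn n, farKernel s z) * u x - 2 * farOp u (farKernel s) x) := by
  rw [← integral_farKernel_mul_secondDiff h.dim_lt h.cont.aestronglyMeasurable h.weighted x]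
  simp only [singularIntegral, ← nearKernel_add_farKernel, add_mul]
  exact integral_add (h.integrable_near x) (h.integrable_far x)

theorem integral_norm_le (h : IsAdmissible s β u) (x : Rn n) :
    ∫ z, ‖‖z‖ ^ (-s) * secondDiff u x z‖ ≤ (∫ z, ‖nearKernel s z * secondDiff u x z‖) +
      (2 * (∫ z : Rn n, farKernel s z) * |u x| + 2 * farOp (fun y => |u y|) (farKernel s) x) := by
  have h1 := integral_farKernel_mul_abs_secondDiff_le h.dim_lt h.cont.aestronglyMeasurable
    h.weighted x
  have h2 := (h.integrable_far x).norm
  have e : ∀ z, ‖farKernel s z * secondDiff u x z‖ = farKernel s z * |secondDiff u x z| :=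
    fun z => by rw [norm_mul, Real.norm_of_nonneg (farKernel_nonneg s z), Real.norm_eq_abs]
  calc ∫ z, ‖‖z‖ ^ (-s) * secondDiff u x z‖
      ≤ ∫ z, (‖nearKernel s z * secondDiff u x z‖ + ‖farKernel s z * secondDiff u x z‖) := by
        refine integral_mono (h.integrable x).norm ((h.integrable_near x).norm.add h2) fun z => ?_
        simp only [← nearKernel_add_farKernel s z, add_mul]
        exact norm_add_le _ _
    _ ≤ _ := by
        rw [integral_add (h.integrable_near x).norm h2]
        simp only [e]
        gcongr

theorem integral_norm_near_le (h : IsAdmissible s β u) (R : ℝ) :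
    ∃ C : ℝ, 0 ≤ C ∧ ∀ x : Rn n, ‖x‖ ≤ R → ∫ z, ‖nearKernel s z * secondDiff u x z‖ ≤ C := by
  obtain ⟨C, hC, hb⟩ := h.bound R
  refine ⟨C * ∫ z : Rn n, |nearKernel s z| * ‖z‖ ^ β,
    mul_nonneg hC (integral_nonneg fun z => by positivity), fun x hx => ?_⟩
  rw [← integral_const_mul]
  exact integral_mono (h.integrable_near x).norm
    ((integrable_nearKernel h.dim_pos h.lt_add).const_mul C)
    fun z => norm_near_le s (hb x z hx)

theorem exists_integral_norm_le (h : IsAdmissible s β u) (R : ℝ) :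
    ∃ C : ℝ, ∀ x : Rn n, ‖x‖ ≤ R → ∫ z, ‖‖z‖ ^ (-s) * secondDiff u x z‖ ≤ C := by
  obtain ⟨C, -, hC⟩ := h.integral_norm_near_le R
  have hc : Continuous fun x => 2 * (∫ z : Rn n, farKernel s z) * |u x| +
      2 * farOp (fun y => |u y|) (farKernel s) x := by
    have h1 := (contDiff_farOp h.pos.le (u := fun y => |u y|) h.cont.norm.aestronglyMeasurable
      (by simpa only [abs_abs] using h.weighted) 0 le_rfl (isFarKernel_farKernel s)).continuous
    exact (continuous_const.mul h.cont.abs).add (continuous_const.mul h1)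
  obtain ⟨M, hM⟩ := (isCompact_closedBall (0 : Rn n) R).exists_bound_of_continuousOn hc.continuousOn
  refine ⟨C + M, fun x hx => (h.integral_norm_le x).trans (add_le_add (hC x hx) ?_)⟩
  exact (le_abs_self _).trans (hM x (by simpa using hx))

theorem contDiff_singularIntegral {a : ℕ} (ha : a ≤ 1) {γ : ℝ} (hγ0 : 0 ≤ γ) (hγ : γ ≤ 1)
    (h : IsAdmissible s (a + γ) u) (k : ℕ) (hu : ContDiff ℝ ((k + a : ℕ) : WithTop ℕ∞) u)
    (hh : HolderOnBalls γ (iteratedFDeriv ℝ (k + a) u)) :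
    ContDiff ℝ (k : WithTop ℕ∞) (singularIntegral s u) := by
  rw [show singularIntegral s u = _ from funext h.singularIntegral_eq]
  have h1 := contDiff_diffOp ha hγ0 hγ (measurable_nearKernel s).aestronglyMeasurable
    (fun z hz => nearKernel_eq_zero s hz) (integrable_nearKernel h.dim_pos h.lt_add) k hu hh
  have h2 := contDiff_farOp h.pos.le h.cont.aestronglyMeasurable h.weighted k le_rfl
    (isFarKernel_farKernel s)
  exact h1.add ((contDiff_const.mul (hu.of_le (by norm_cast; omega))).sub (contDiff_const.mul h2))

end IsAdmissible

theorem one_le_one_add_norm_rpow {s R : ℝ} (hs : 0 ≤ s) {x : Rn n} (hx : ‖x‖ ≤ R) :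
    1 ≤ (1 + R) ^ s * (1 + ‖x‖) ^ (-s) := by
  simpa using one_add_norm_rpow_neg_le hs hx (y := x)

/-! ### Identification with the principal value -/

namespace IsAdmissible

variable {s β : ℝ} {u : Rn n → ℝ}

theorem integrable_weight_translate (h : IsAdmissible s β u) (x : Rn n) :
    Integrable fun z => |u (x + z)| * (1 + ‖z‖) ^ (-s) := by
  have hc := h.cont
  refine ((h.weighted.comp_add_left x).const_mul ((1 + ‖x‖) ^ s)).mono' ?_
    (Eventually.of_forall fun z => ?_)
  · refine Continuous.aestronglyMeasurable (Continuous.mul (by fun_prop) ?_)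
    exact Continuous.rpow_const (by fun_prop) fun z => Or.inl (by positivity)
  · have := one_add_norm_rpow_neg_le h.pos.le le_rfl (x := x) (y := x + z)
    rw [sub_add_cancel_left, norm_neg] at this
    rw [Real.norm_of_nonneg (by positivity)]
    calc |u (x + z)| * (1 + ‖z‖) ^ (-s)
        ≤ |u (x + z)| * ((1 + ‖x‖) ^ s * (1 + ‖x + z‖) ^ (-s)) := by gcongr
      _ = _ := by ring

theorem integrableOn_difference (h : IsAdmissible s β u) (x : Rn n) {ε : ℝ} (hε : 0 < ε) :
    IntegrableOn (fun z => ‖z‖ ^ (-s) * (u x - u (x + z))) {z : Rn n | ε ≤ ‖z‖} := by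
  have hc := h.cont
  have hS : MeasurableSet {z : Rn n | ε ≤ ‖z‖} := measurableSet_le measurable_const measurable_norm
  have hi := ((((integrable_one_add_norm_rpow_neg (n := n) h.dim_lt).const_mul |u x|).add
    (h.integrable_weight_translate x)).const_mul (((1 + ε) / ε) ^ s)).integrableOn
      (s := {z : Rn n | ε ≤ ‖z‖})
  refine hi.mono' ((measurable_norm_rpow _).aestronglyMeasurable.mul
    (by fun_prop : Continuous fun z => u x - u (x + z)).aestronglyMeasurable)
    ((ae_restrict_iff' hS).2 (Eventually.of_forall fun z hz => ?_))
  have hz : ε ≤ ‖z‖ := hz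
  -- Away from the origin ‖z‖ and 1 + ‖z‖ are comparable; this fixes the constant ((1+ε)/ε)^s.
  have h1 : 1 + ‖z‖ ≤ (1 + ε) / ε * ‖z‖ := by
    rw [div_mul_eq_mul_div, le_div_iff₀ hε]; nlinarith
  have h2 : ‖z‖ ^ (-s) ≤ ((1 + ε) / ε) ^ s * (1 + ‖z‖) ^ (-s) := by
    have hz0 : 0 < ‖z‖ := hε.trans_le hz
    have h3 : ((1 + ε) / ε * ‖z‖) ^ (-s) ≤ (1 + ‖z‖) ^ (-s) :=
      Real.rpow_le_rpow_of_nonpos (by positivity) h1 (by linarith [h.pos])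
    rw [Real.mul_rpow (by positivity) (by positivity)] at h3
    calc ‖z‖ ^ (-s) = ((1 + ε) / ε) ^ s * (((1 + ε) / ε) ^ (-s) * ‖z‖ ^ (-s)) := by
          rw [← mul_assoc, ← Real.rpow_add (by positivity)]; simp
      _ ≤ _ := by gcongr
  rw [norm_mul, Real.norm_of_nonneg (by positivity), Real.norm_eq_abs]
  calc ‖z‖ ^ (-s) * |u x - u (x + z)|
      ≤ (((1 + ε) / ε) ^ s * (1 + ‖z‖) ^ (-s)) * (|u x| + |u (x + z)|) := by
        gcongr; exact abs_sub _ _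
    _ = _ := by simp only [Pi.add_apply]; ring

end IsAdmissible

theorem setIntegral_difference_eq (s : ℝ) (u : Rn n → ℝ) (x : Rn n) (ε : ℝ) :
    ∫ y in {y : Rn n | ε ≤ ‖y - x‖}, (u x - u y) / ‖x - y‖ ^ s =
      ∫ z in {z : Rn n | ε ≤ ‖z‖}, ‖z‖ ^ (-s) * (u x - u (x + z)) := by
  have hS : MeasurableSet {z : Rn n | ε ≤ ‖z‖} := measurableSet_le measurable_const measurable_norm
  have hS' : MeasurableSet {y : Rn n | ε ≤ ‖y - x‖} :=
    measurableSet_le measurable_const (by fun_prop)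
  rw [← integral_indicator hS, ← integral_indicator hS', ← integral_add_left_eq_self _ x]
  congr 1; ext z
  simp only [Set.indicator, Set.mem_ofPred_eq, add_sub_cancel_left, sub_add_cancel_left, norm_neg,
    Real.rpow_neg (norm_nonneg z), div_eq_inv_mul]

theorem setIntegral_difference_neg (s : ℝ) (u : Rn n → ℝ) (x : Rn n) (ε : ℝ) :
    ∫ z in {z : Rn n | ε ≤ ‖z‖}, ‖z‖ ^ (-s) * (u x - u (x + z)) =
      ∫ z in {z : Rn n | ε ≤ ‖z‖}, ‖z‖ ^ (-s) * (u x - u (x - z)) := by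
  have hS : MeasurableSet {z : Rn n | ε ≤ ‖z‖} := measurableSet_le measurable_const measurable_norm
  rw [← integral_indicator hS, ← integral_indicator hS, ← integral_neg_eq_self]
  simp only [Set.indicator, Set.mem_ofPred_eq, norm_neg, ← sub_eq_add_neg]

/-- The truncated region and the kernel are invariant under z ↦ -z; averaging the two forms of the
integral produces the factor 1/2. -/
theorem IsAdmissible.truncFracLaplacian_eq {α β : ℝ} {u : Rn n → ℝ}
    (h : IsAdmissible ((n : ℝ) + α) β u) (x : Rn n) {ε : ℝ} (hε : 0 < ε) :
    truncFracLaplacian α u x ε = fracConst n α / 2 *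
      ∫ z in {z : Rn n | ε ≤ ‖z‖}, ‖z‖ ^ (-((n : ℝ) + α)) * secondDiff u x z := by
  have h1 := h.integrableOn_difference x hε
  have h2 : IntegrableOn (fun z => ‖z‖ ^ (-((n : ℝ) + α)) * (u x - u (x - z)))
      {z : Rn n | ε ≤ ‖z‖} := by
    have hS : MeasurableSet {z : Rn n | ε ≤ ‖z‖} :=
      measurableSet_le measurable_const measurable_norm
    rw [← integrable_indicator_iff hS] at h1 ⊢
    refine h1.comp_neg.congr (Eventually.of_forall fun z => ?_)
    simp only [Set.indicator, Set.mem_ofPred_eq, norm_neg, ← sub_eq_add_neg]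
  have e : ∫ z in {z : Rn n | ε ≤ ‖z‖}, ‖z‖ ^ (-((n : ℝ) + α)) * secondDiff u x z =
      2 * ∫ z in {z : Rn n | ε ≤ ‖z‖}, ‖z‖ ^ (-((n : ℝ) + α)) * (u x - u (x + z)) := by
    simp only [secondDiff, mul_add]
    rw [integral_add h1 h2, ← setIntegral_difference_neg]
    ring
  rw [truncFracLaplacian, setIntegral_difference_eq, e]
  ring

/-- The principal value converges, to the absolutely convergent symmetrized integral. -/
theorem IsAdmissible.tendsto_truncFracLaplacian {α β : ℝ} {u : Rn n → ℝ}
    (h : IsAdmissible ((n : ℝ) + α) β u) (x : Rn n) :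
    Tendsto (truncFracLaplacian α u x) (𝓝[>] (0 : ℝ))
      (𝓝 (fracConst n α / 2 * singularIntegral ((n : ℝ) + α) u x)) := by
  set g : Rn n → ℝ := fun z => ‖z‖ ^ (-((n : ℝ) + α)) * secondDiff u x z
  have hlim : Tendsto (fun ε : ℝ => ∫ z in {z : Rn n | ε ≤ ‖z‖}, g z) (𝓝[>] 0)
      (𝓝 (∫ z, g z)) := by
    have hS : ∀ ε : ℝ, MeasurableSet {z : Rn n | ε ≤ ‖z‖} := fun ε =>
      measurableSet_le measurable_const measurable_norm
    simp only [← integral_indicator (hS _)]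
    refine tendsto_integral_filter_of_dominated_convergence (fun z => ‖g z‖)
      (Eventually.of_forall fun ε => ((h.integrable x).indicator (hS ε)).aestronglyMeasurable)
      (Eventually.of_forall fun ε => Eventually.of_forall fun z => norm_indicator_le_norm_self _ _)
      (h.integrable x).norm (Eventually.of_forall fun z => ?_)
    -- At the origin the integrand is 0; elsewhere the indicator is 1 as soon as ε ≤ ‖z‖.
    rcases eq_or_ne z 0 with rfl | hz
    · have : g 0 = 0 := by simp [g, secondDiff]
      refine tendsto_const_nhds.congr fun ε => ?_
      simp [Set.indicator, this]
    · refine tendsto_const_nhds.congr' ?_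
      have : Set.Ioc (0 : ℝ) ‖z‖ ∈ 𝓝[>] (0 : ℝ) :=
        Ioc_mem_nhdsGT (norm_pos_iff.2 hz)
      filter_upwards [this] with ε hε
      exact (Set.indicator_of_mem (s := {z : Rn n | ε ≤ ‖z‖}) hε.2 g).symm
  refine (hlim.const_mul (fracConst n α / 2)).congr' ?_
  filter_upwards [self_mem_nhdsWithin] with ε hε
  exact (h.truncFracLaplacian_eq x hε).symm

theorem IsAdmissible.fracLaplacian_eq {α β : ℝ} {u : Rn n → ℝ}
    (h : IsAdmissible ((n : ℝ) + α) β u) :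
    fracLaplacian α u = fun x => fracConst n α / 2 * singularIntegral ((n : ℝ) + α) u x :=
  funext fun x => (h.tendsto_truncFracLaplacian x).limUnder_eq

/-! ### Test functions: decay and symmetry -/

theorem isAdmissible_of_hasCompactSupport (hn : 1 ≤ n) {s : ℝ} (hs : (n : ℝ) < s) (hs2 : s < n + 2)
    {φ : Rn n → ℝ} (hφ : ContDiff ℝ 2 φ) (hc : HasCompactSupport φ) : IsAdmissible s 2 φ where
  dim_pos := hn
  dim_lt := hs
  lt_add := hs2
  cont := hφ.continuous
  weighted := by
    refine Continuous.integrable_of_hasCompactSupport ?_ hc.abs.mul_right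
    exact hφ.continuous.abs.mul
      (Continuous.rpow_const (by fun_prop) fun z => Or.inl (by positivity))
  bound := by
    have := (holderOnBalls_of_contDiff_one (γ := 1) le_rfl
      (hφ.fderiv_right (m := 1) (by norm_num))).secondDiffBound_of_fderiv zero_le_one
      (hφ.differentiable (by simp))
    norm_num at this
    exact this

/-- The singular integral of a compactly supported function decays like `‖x‖^{-s}`. -/
theorem IsAdmissible.exists_integral_norm_le_rpow {s β : ℝ} {φ : Rn n → ℝ}
    (h : IsAdmissible s β φ) (hc : HasCompactSupport φ) :
    ∃ B : ℝ, ∀ x, ∫ z, ‖‖z‖ ^ (-s) * secondDiff φ x z‖ ≤ B * (1 + ‖x‖) ^ (-s) := by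
  have hs := h.pos.le
  obtain ⟨ρ, hρ, hsupp⟩ := hc.isCompact.isBounded.exists_pos_norm_le
  have hz : ∀ y : Rn n, ρ < ‖y‖ → φ y = 0 := fun y hy => by
    by_contra hne
    exact absurd (hsupp y (subset_tsupport φ hne)) (not_le.2 hy)
  -- The near kernel reaches distance one, so the near part vanishes beyond radius ρ + 1.
  obtain ⟨N, hN0, hN⟩ := h.integral_norm_near_le (ρ + 1)
  have near : ∀ x, ∫ z, ‖nearKernel s z * secondDiff φ x z‖ ≤
      N * (1 + (ρ + 1)) ^ s * (1 + ‖x‖) ^ (-s) := by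
    intro x
    by_cases hx : ‖x‖ ≤ ρ + 1
    · have := one_le_one_add_norm_rpow hs hx
      rw [mul_assoc]
      exact (hN x hx).trans (le_mul_of_one_le_right hN0 this)
    · push Not at hx
      have e : ∀ z, nearKernel s z * secondDiff φ x z = 0 := fun z => by
        by_cases hz1 : 1 < ‖z‖
        · rw [nearKernel_eq_zero s hz1, zero_mul]
        · have h1 : ρ < ‖x + z‖ := by
            have := norm_sub_le (x + z) z; rw [add_sub_cancel_right] at this; linarith
          have h2 : ρ < ‖x - z‖ := by
            have := norm_add_le (x - z) z; rw [sub_add_cancel] at this; linarith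
          simp [secondDiff, hz x (by linarith), hz _ h1, hz _ h2]
      simp only [e, norm_zero, integral_zero]
      positivity
  obtain ⟨M, hM⟩ := hc.exists_bound_of_continuous h.cont
  have hM0 : 0 ≤ M := (norm_nonneg _).trans (hM 0)
  have mid : ∀ x, |φ x| ≤ M * (1 + ρ) ^ s * (1 + ‖x‖) ^ (-s) := by
    intro x
    by_cases hx : ‖x‖ ≤ ρ
    · have := one_le_one_add_norm_rpow hs hx
      rw [mul_assoc]
      exact (hM x).trans (le_mul_of_one_le_right hM0 this)
    · rw [hz x (not_le.1 hx), abs_zero]; positivity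
  obtain ⟨C, hC, hG⟩ := (isFarKernel_farKernel (n := n) s).exists_norm_le hs le_rfl
  have hφi : Integrable fun y => |φ y| := (h.cont.integrable_of_hasCompactSupport hc).abs
  have far : ∀ x, farOp (fun y => |φ y|) (farKernel s) x ≤
      (∫ y, |φ y|) * (C * (1 + ρ) ^ s) * (1 + ‖x‖) ^ (-s) := by
    intro x
    rw [mul_assoc, ← integral_mul_const]
    refine integral_mono_of_nonneg (Eventually.of_forall fun y =>
      mul_nonneg (abs_nonneg _) (farKernel_nonneg _ _)) (hφi.mul_const _)
      (Eventually.of_forall fun y => ?_)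
    by_cases hy : ‖y‖ ≤ ρ
    · have h1 := one_add_norm_rpow_neg_le hs hy (y := x)
      rw [norm_sub_rev] at h1
      have h2 := (le_abs_self _).trans (hG (x - y))
      simp only [smul_eq_mul]
      gcongr
      calc farKernel s (x - y) ≤ C * (1 + ‖x - y‖) ^ (-s) := h2
        _ ≤ C * ((1 + ρ) ^ s * (1 + ‖x‖) ^ (-s)) := by gcongr
        _ = _ := by ring
    · simp [hz y (not_le.1 hy)]
  have hI : 0 ≤ ∫ z : Rn n, farKernel s z := integral_nonneg (farKernel_nonneg s)
  refine ⟨N * (1 + (ρ + 1)) ^ s + (2 * (∫ z : Rn n, farKernel s z) * (M * (1 + ρ) ^ s) +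
    2 * ((∫ y, |φ y|) * (C * (1 + ρ) ^ s))), fun x => (h.integral_norm_le x).trans ?_⟩
  have h1 := mul_le_mul_of_nonneg_left (mid x) (mul_nonneg zero_le_two hI)
  have h2 := mul_le_mul_of_nonneg_left (far x) zero_le_two
  linarith [near x]

theorem aestronglyMeasurable_kernel_secondDiff (s : ℝ) {u : Rn n → ℝ} (hu : Continuous u) :
    AEStronglyMeasurable (fun p : Rn n × Rn n => ‖p.2‖ ^ (-s) * secondDiff u p.1 p.2)
      (volume.prod volume) :=
  (((measurable_norm_rpow (-s)).comp measurable_snd).aestronglyMeasurable).mul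
    (continuous_secondDiff hu).aestronglyMeasurable

/-- Translation invariance exchanges the shifts by z and -z, and the second difference is even in z.
-/
theorem integral_secondDiff_mul {u φ : Rn n → ℝ} (hu : Continuous u) (hφ : Continuous φ)
    (hc : HasCompactSupport φ) (z : Rn n) :
    ∫ x, secondDiff u x z * φ x = ∫ x, u x * secondDiff φ x z := by
  have hca : HasCompactSupport fun x => φ (x - z) := by
    simpa only [Homeomorph.coe_addRight, Function.comp_def, sub_eq_add_neg] using
      hc.comp_homeomorph (Homeomorph.addRight (-z))
  have hcs : HasCompactSupport fun x => φ (x + z) := by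
    simpa only [Homeomorph.coe_addRight, Function.comp_def] using
      hc.comp_homeomorph (Homeomorph.addRight z)
  have i0 : Integrable fun x => u x * φ x :=
    (hu.mul hφ).integrable_of_hasCompactSupport hc.mul_left
  have i1 : Integrable fun x => u x * φ (x - z) :=
    Continuous.integrable_of_hasCompactSupport (by fun_prop) hca.mul_left
  have i2 : Integrable fun x => u x * φ (x + z) :=
    Continuous.integrable_of_hasCompactSupport (by fun_prop) hcs.mul_left
  have j1 : Integrable fun x => u (x + z) * φ x := by simpa using i1.comp_add_right z
  have j2 : Integrable fun x => u (x - z) * φ x := by simpa using i2.comp_sub_right z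
  have e1 : ∫ x, u (x + z) * φ x = ∫ x, u x * φ (x - z) := by
    simpa using integral_add_right_eq_self (fun x => u x * φ (x - z)) z
  have e2 : ∫ x, u (x - z) * φ x = ∫ x, u x * φ (x + z) := by
    simpa using integral_sub_right_eq_self (fun x => u x * φ (x + z)) z
  calc ∫ x, secondDiff u x z * φ x
      = ∫ x, ((u x * φ x - u (x + z) * φ x) + (u x * φ x - u (x - z) * φ x)) := by
        congr 1; ext x; simp only [secondDiff]; ring
    _ = ∫ x, ((u x * φ x - u x * φ (x + z)) + (u x * φ x - u x * φ (x - z))) := by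
        rw [integral_add (by exact i0.sub j1) (by exact i0.sub j2), integral_sub i0 j1,
          integral_sub i0 j2, integral_add (by exact i0.sub i2) (by exact i0.sub i1),
          integral_sub i0 i2, integral_sub i0 i1, e1, e2]
        ring
    _ = _ := by congr 1; ext x; simp only [secondDiff]; ring

/-- The singular integral operator is symmetric when tested against compactly supported
functions. -/
theorem IsAdmissible.integral_singularIntegral_mul {s β β' : ℝ} {u φ : Rn n → ℝ}
    (hu : IsAdmissible s β u) (hφ : IsAdmissible s β' φ) (hc : HasCompactSupport φ) :
    ∫ x, singularIntegral s u x * φ x = ∫ x, u x * singularIntegral s φ x := by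
  have huc := hu.cont
  have hφc := hφ.cont
  have m1 : AEStronglyMeasurable (fun p : Rn n × Rn n =>
      ‖p.2‖ ^ (-s) * secondDiff u p.1 p.2 * φ p.1) (volume.prod volume) :=
    (aestronglyMeasurable_kernel_secondDiff s huc).mul
      (by fun_prop : Continuous fun p : Rn n × Rn n => φ p.1).aestronglyMeasurable
  have m2 : AEStronglyMeasurable (fun p : Rn n × Rn n =>
      ‖p.2‖ ^ (-s) * secondDiff φ p.1 p.2 * u p.1) (volume.prod volume) :=
    (aestronglyMeasurable_kernel_secondDiff s hφc).mul
      (by fun_prop : Continuous fun p : Rn n × Rn n => u p.1).aestronglyMeasurable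
  -- Fubini's hypothesis here: the inner integrals are uniformly bounded on the support of φ.
  have I1 : Integrable (fun p : Rn n × Rn n =>
      ‖p.2‖ ^ (-s) * secondDiff u p.1 p.2 * φ p.1) (volume.prod volume) := by
    refine (integrable_prod_iff m1).2 ⟨Eventually.of_forall fun x =>
      (hu.integrable x).mul_const (φ x), ?_⟩
    obtain ⟨ρ, -, hsupp⟩ := hc.isCompact.isBounded.exists_pos_norm_le
    obtain ⟨C, hC⟩ := hu.exists_integral_norm_le ρ
    refine ((hφc.integrable_of_hasCompactSupport hc).norm.const_mul C).mono'
      m1.norm.integral_prod_right' (Eventually.of_forall fun x => ?_)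
    rw [Real.norm_of_nonneg (integral_nonneg fun z => norm_nonneg _)]
    simp only [norm_mul _ (φ x)]
    rw [integral_mul_const]
    by_cases hx : φ x = 0
    · simp [hx]
    · gcongr
      exact hC x (hsupp x (subset_tsupport φ hx))
  -- Now φ lies inside the operator; the inner integral decays like the weight in which u is
  -- integrable.
  have I2 : Integrable (fun p : Rn n × Rn n =>
      ‖p.2‖ ^ (-s) * secondDiff φ p.1 p.2 * u p.1) (volume.prod volume) := by
    refine (integrable_prod_iff m2).2 ⟨Eventually.of_forall fun x =>
      (hφ.integrable x).mul_const (u x), ?_⟩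
    obtain ⟨B, hB⟩ := hφ.exists_integral_norm_le_rpow hc
    refine (hu.weighted.const_mul B).mono'
      m2.norm.integral_prod_right' (Eventually.of_forall fun x => ?_)
    rw [Real.norm_of_nonneg (integral_nonneg fun z => norm_nonneg _)]
    simp only [norm_mul _ (u x)]
    rw [integral_mul_const, Real.norm_eq_abs]
    calc _ ≤ B * (1 + ‖x‖) ^ (-s) * |u x| := by gcongr; exact hB x
      _ = _ := by ring
  calc ∫ x, singularIntegral s u x * φ x
      = ∫ x, ∫ z, ‖z‖ ^ (-s) * secondDiff u x z * φ x := by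
        simp only [singularIntegral, integral_mul_const]
    _ = ∫ z, ∫ x, ‖z‖ ^ (-s) * secondDiff u x z * φ x := integral_integral_swap I1
    _ = ∫ z, ∫ x, ‖z‖ ^ (-s) * secondDiff φ x z * u x := by
        congr 1; ext z
        simp only [mul_assoc, integral_const_mul]
        rw [integral_secondDiff_mul huc hφc hc]
        simp only [mul_comm]
    _ = ∫ x, ∫ z, ‖z‖ ^ (-s) * secondDiff φ x z * u x := (integral_integral_swap I2).symm
    _ = _ := by
        simp only [singularIntegral, integral_mul_const]
        simp only [mul_comm]

/-! ### Scaling and vanishing averages -/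

theorem singularIntegral_rescale (s : ℝ) (ψ : Rn n → ℝ) (x₀ x : Rn n) {R : ℝ} (hR : 0 < R) :
    singularIntegral s (fun x => ψ (R⁻¹ • (x - x₀))) x =
      R ^ n * R ^ (-s) * singularIntegral s ψ (R⁻¹ • (x - x₀)) := by
  have h := Measure.integral_comp_smul (volume : Measure (Rn n))
    (fun z => ‖z‖ ^ (-s) * secondDiff (fun x => ψ (R⁻¹ • (x - x₀))) x z) R
  have e : ∀ z : Rn n, ‖R • z‖ ^ (-s) * secondDiff (fun x => ψ (R⁻¹ • (x - x₀))) x (R • z) =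
      R ^ (-s) * (‖z‖ ^ (-s) * secondDiff ψ (R⁻¹ • (x - x₀)) z) := fun z => by
    have h1 : R⁻¹ • (x + R • z - x₀) = R⁻¹ • (x - x₀) + z := by
      rw [add_sub_right_comm, smul_add, smul_smul, inv_mul_cancel₀ hR.ne', one_smul]
    have h2 : R⁻¹ • (x - R • z - x₀) = R⁻¹ • (x - x₀) - z := by
      rw [sub_right_comm, smul_sub, smul_smul, inv_mul_cancel₀ hR.ne', one_smul]
    rw [norm_smul, Real.norm_of_nonneg hR.le, Real.mul_rpow hR.le (norm_nonneg _)]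
    simp only [secondDiff, h1, h2]
    ring
  simp only [e, integral_const_mul, finrank_euclideanSpace, Fintype.card_fin, smul_eq_mul,
    abs_of_pos (inv_pos.2 (pow_pos hR n))] at h
  rw [singularIntegral, singularIntegral, mul_assoc, h, ← mul_assoc,
    mul_inv_cancel₀ (pow_pos hR n).ne', one_mul]

/-- The averages of `v` against rescaled test functions vanish as the scale tends to infinity. -/
def AveragesVanish (v : Rn n → ℝ) : Prop :=
  ∀ (ψ : Rn n → ℝ), ContDiff ℝ (⊤ : ℕ∞) ψ → HasCompactSupport ψ → ∀ x₀ : Rn n,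
    Tendsto (fun R : ℝ => ∫ y, v (x₀ + R • y) * ψ y) atTop (𝓝 0)

theorem AveragesVanish.const_mul {v : Rn n → ℝ} (h : AveragesVanish v) (c : ℝ) :
    AveragesVanish fun x => c * v x := by
  intro ψ hψ hc x₀
  simpa only [mul_assoc, integral_const_mul, mul_zero] using (h ψ hψ hc x₀).const_mul c

theorem integral_comp_add_smul (g : Rn n → ℝ) (x₀ : Rn n) {R : ℝ} (hR : 0 < R) :
    ∫ y, g (x₀ + R • y) = (R ^ n)⁻¹ * ∫ x, g x := by
  have h := Measure.integral_comp_smul (volume : Measure (Rn n)) (fun x => g (x₀ + x)) R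
  rw [h, integral_add_left_eq_self, finrank_euclideanSpace, Fintype.card_fin,
    abs_of_pos (inv_pos.2 (pow_pos hR n)), smul_eq_mul]

/-- Symmetry moves the operator onto the rescaled test function, and scaling leaves u integrated
against a function bounded by B (R + ‖x - x₀‖)^(-s). This tends to 0 pointwise and, for R ≥ 1, is
dominated by the weight. -/
theorem IsAdmissible.averagesVanish {s β : ℝ} {u : Rn n → ℝ} (hu : IsAdmissible s β u)
    (hs2 : s < n + 2) : AveragesVanish (singularIntegral s u) := by
  intro ψ hψ hc x₀
  have hs := hu.pos
  have hψ2 : ContDiff ℝ 2 ψ := mod_cast contDiff_infty.1 hψ 2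
  have hA := isAdmissible_of_hasCompactSupport hu.dim_pos hu.dim_lt hs2 hψ2 hc
  obtain ⟨B, hB⟩ := hA.exists_integral_norm_le_rpow hc
  have hB' : ∀ x, |singularIntegral s ψ x| ≤ B * (1 + ‖x‖) ^ (-s) := fun x =>
    (norm_integral_le_integral_norm _).trans (hB x)
  have hB0 : 0 ≤ B := by simpa using (abs_nonneg _).trans (hB' 0)
  -- The Jacobian R^(-n) of the substitution cancels the R^n from `singularIntegral_rescale`.
  have key : ∀ R : ℝ, 0 < R → ∫ y, singularIntegral s u (x₀ + R • y) * ψ y =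
      ∫ x, u x * (R ^ (-s) * singularIntegral s ψ (R⁻¹ • (x - x₀))) := by
    intro R hR
    have h1 := integral_comp_add_smul
      (fun x => singularIntegral s u x * ψ (R⁻¹ • (x - x₀))) x₀ hR
    simp only [add_sub_cancel_left, smul_smul, inv_mul_cancel₀ hR.ne', one_smul] at h1
    have hd : ContDiff ℝ 2 fun x => ψ (R⁻¹ • (x - x₀)) := by fun_prop
    have hc' : HasCompactSupport fun x => ψ (R⁻¹ • (x - x₀)) := by
      have := (hc.comp_smul (inv_ne_zero hR.ne')).comp_homeomorph (Homeomorph.addRight (-x₀))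
      simpa only [Homeomorph.coe_addRight, Function.comp_def, ← sub_eq_add_neg] using this
    rw [h1, hu.integral_singularIntegral_mul
      (isAdmissible_of_hasCompactSupport hu.dim_pos hu.dim_lt hs2 hd hc') hc',
      ← integral_const_mul]
    congr 1; ext x
    rw [singularIntegral_rescale s ψ x₀ x hR]
    have := (pow_pos hR n).ne'
    field_simp
  have bound : ∀ R : ℝ, 0 < R → ∀ x, ‖u x * (R ^ (-s) * singularIntegral s ψ (R⁻¹ • (x - x₀)))‖ ≤
      |u x| * (B * (R + ‖x - x₀‖) ^ (-s)) := by
    intro R hR x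
    rw [norm_mul, norm_mul, Real.norm_of_nonneg (Real.rpow_nonneg hR.le _), Real.norm_eq_abs,
      Real.norm_eq_abs]
    refine mul_le_mul_of_nonneg_left ?_ (abs_nonneg _)
    calc R ^ (-s) * |singularIntegral s ψ (R⁻¹ • (x - x₀))|
        ≤ R ^ (-s) * (B * (1 + ‖R⁻¹ • (x - x₀)‖) ^ (-s)) := by gcongr; exact hB' _
      _ = B * (R * (1 + ‖R⁻¹ • (x - x₀)‖)) ^ (-s) := by
        rw [Real.mul_rpow hR.le (by positivity)]; ring
      _ = _ := by
        rw [norm_smul, norm_inv, Real.norm_of_nonneg hR.le]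
        rw [show R * (1 + R⁻¹ * ‖x - x₀‖) = R + ‖x - x₀‖ by field_simp]
  have hsc : Continuous (singularIntegral s ψ) := by
    have := IsAdmissible.contDiff_singularIntegral (s := s) (u := ψ) (a := 1) (γ := 1) le_rfl
      zero_le_one le_rfl (by norm_num; exact hA) 0 (hψ.of_le (by simp)) (by
        refine holderOnBalls_of_contDiff_one le_rfl ?_
        exact hψ2.iteratedFDeriv_right (by norm_num))
    exact this.continuous
  have hucont := hu.cont
  have lim : Tendsto (fun R : ℝ => ∫ x, u x * (R ^ (-s) * singularIntegral s ψ (R⁻¹ • (x - x₀))))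
      atTop (𝓝 (∫ _ : Rn n, (0 : ℝ))) := by
    refine tendsto_integral_filter_of_dominated_convergence
      (fun x => B * (1 + ‖x₀‖) ^ s * (|u x| * (1 + ‖x‖) ^ (-s)))
      (Eventually.of_forall fun R => (by fun_prop : Continuous fun x =>
        u x * (R ^ (-s) * singularIntegral s ψ (R⁻¹ • (x - x₀)))).aestronglyMeasurable)
      ?_ (hu.weighted.const_mul _) (Eventually.of_forall fun x => ?_)
    · filter_upwards [eventually_ge_atTop 1] with R hR
      refine Eventually.of_forall fun x => (bound R (by linarith) x).trans ?_
      have h1 : (R + ‖x - x₀‖) ^ (-s) ≤ (1 + ‖x₀‖) ^ s * (1 + ‖x‖) ^ (-s) := by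
        refine le_trans ?_ (one_add_norm_rpow_neg_le hs.le le_rfl)
        rw [norm_sub_rev]
        exact Real.rpow_le_rpow_of_nonpos (by positivity) (by linarith) (by linarith)
      calc |u x| * (B * (R + ‖x - x₀‖) ^ (-s))
          ≤ |u x| * (B * ((1 + ‖x₀‖) ^ s * (1 + ‖x‖) ^ (-s))) := by gcongr
        _ = _ := by ring
    · have h0 : Tendsto (fun R : ℝ => |u x| * (B * (R + ‖x - x₀‖) ^ (-s))) atTop (𝓝 0) := by
        have := ((tendsto_rpow_neg_atTop hs).comp
          (tendsto_atTop_add_const_right _ ‖x - x₀‖ tendsto_id)).const_mul B |>.const_mul |u x|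
        simpa using this
      refine squeeze_zero_norm' ?_ h0
      filter_upwards [eventually_gt_atTop 0] with R hR using bound R hR x
  rw [integral_zero] at lim
  refine lim.congr' ?_
  filter_upwards [eventually_gt_atTop 0] with R hR using (key R hR).symm

/-! ### Averages of Laplacians -/

/-- The derivative of `v` in the `i`-th coordinate direction. -/
def partialDeriv (i : Fin n) (v : Rn n → ℝ) (x : Rn n) : ℝ :=
  fderiv ℝ v x (EuclideanSpace.basisFun (Fin n) ℝ i)

theorem contDiff_partialDeriv {k m : WithTop ℕ∞} (i : Fin n) {v : Rn n → ℝ} (hv : ContDiff ℝ m v)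
    (h : k + 1 ≤ m) : ContDiff ℝ k (partialDeriv i v) :=
  (hv.fderiv_right h).clm_apply contDiff_const

theorem hasCompactSupport_partialDeriv (i : Fin n) {v : Rn n → ℝ} (hv : HasCompactSupport v) :
    HasCompactSupport (partialDeriv i v) :=
  hv.fderiv_apply (𝕜 := ℝ) _

theorem laplacian_eq_sum_partialDeriv {v : Rn n → ℝ} (hv : ContDiff ℝ 2 v) (x : Rn n) :
    Laplacian.laplacian v x = ∑ i, partialDeriv i (partialDeriv i v) x := by
  rw [laplacian_eq_iteratedFDeriv_orthonormalBasis v (EuclideanSpace.basisFun (Fin n) ℝ)]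
  refine Finset.sum_congr rfl fun i _ => ?_
  have hd : DifferentiableAt ℝ (fderiv ℝ v) x :=
    (hv.fderiv_right (m := 1) (by norm_num)).differentiable one_ne_zero x
  rw [iteratedFDeriv_two_apply]
  unfold partialDeriv
  rw [fderiv_clm_apply hd (differentiableAt_const _)]
  simp

theorem contDiff_laplacian {k : ℕ} {v : Rn n → ℝ}
    (hv : ContDiff ℝ ((k + 2 : ℕ) : WithTop ℕ∞) v) :
    ContDiff ℝ (k : WithTop ℕ∞) (Laplacian.laplacian v) := by
  have h2 : ContDiff ℝ 2 v := hv.of_le (by norm_cast; omega)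
  rw [show Laplacian.laplacian v = _ from funext (laplacian_eq_sum_partialDeriv h2)]
  exact ContDiff.sum fun i _ => contDiff_partialDeriv (m := ((k + 1 : ℕ) : WithTop ℕ∞)) i
    (contDiff_partialDeriv i hv (by norm_cast)) (by norm_cast)

theorem integral_comp_mul_partialDeriv (i : Fin n) {g ψ : Rn n → ℝ} (hg : ContDiff ℝ 1 g)
    (hψ : ContDiff ℝ 1 ψ) (hc : HasCompactSupport ψ) (x₀ : Rn n) (R : ℝ) :
    ∫ y, g (x₀ + R • y) * partialDeriv i ψ y =
      -(R * ∫ y, partialDeriv i g (x₀ + R • y) * ψ y) := by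
  set e := EuclideanSpace.basisFun (Fin n) ℝ i
  have hgc := hg.continuous
  have hψc := hψ.continuous
  have hg' := (contDiff_partialDeriv (k := 0) i hg (by norm_num)).continuous
  have hψ' := (contDiff_partialDeriv (k := 0) i hψ (by norm_num)).continuous
  have hd : ∀ y, HasFDerivAt (fun y => g (x₀ + R • y))
      ((fderiv ℝ g (x₀ + R • y)).comp (R • ContinuousLinearMap.id ℝ (Rn n))) y := fun y =>
    ((hg.differentiable one_ne_zero _).hasFDerivAt).comp y
      (((hasFDerivAt_id y).const_smul R).const_add x₀)
  have hd' : ∀ y, fderiv ℝ (fun y => g (x₀ + R • y)) y e = R * partialDeriv i g (x₀ + R • y) :=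
    fun y => by rw [(hd y).fderiv]; simp [partialDeriv, e]
  have key := integral_mul_fderiv_eq_neg_fderiv_mul_of_integrable (μ := volume)
    (f := fun y => g (x₀ + R • y)) (g := ψ) (v := e) ?_ ?_ ?_
    (fun y _ => (hd y).differentiableAt) (fun y _ => hψ.differentiable one_ne_zero y)
  · simp only [hd', mul_assoc, integral_const_mul] at key
    exact key
  · simp only [hd']
    exact Continuous.integrable_of_hasCompactSupport (by fun_prop) hc.mul_left
  · exact Continuous.integrable_of_hasCompactSupport (f := fun y => g (x₀ + R • y) *
      partialDeriv i ψ y) (by fun_prop) (hasCompactSupport_partialDeriv i hc).mul_left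
  · exact Continuous.integrable_of_hasCompactSupport (by fun_prop) hc.mul_left

/-- Two integrations by parts put the derivatives on ψ with a factor R^(-2); the second partials of
ψ are again admissible test functions. -/
theorem AveragesVanish.laplacian {v : Rn n → ℝ} (h : AveragesVanish v) (hv : ContDiff ℝ 2 v) :
    AveragesVanish (Laplacian.laplacian v) := by
  intro ψ hψ hc x₀
  have h1 : ∀ i, ContDiff ℝ 1 (partialDeriv i v) := fun i =>
    contDiff_partialDeriv i hv (by norm_num)
  have h2 : ∀ i, Continuous (partialDeriv i (partialDeriv i v)) := fun i =>
    (contDiff_partialDeriv (k := 0) i (h1 i) (by norm_num)).continuous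
  have hψ' : ∀ i, ContDiff ℝ (⊤ : ℕ∞) (partialDeriv i ψ) := fun i =>
    contDiff_partialDeriv i hψ (by simp)
  have hψ1 : ContDiff ℝ 1 ψ := mod_cast contDiff_infty.1 hψ 1
  have hψ1' : ∀ i, ContDiff ℝ 1 (partialDeriv i ψ) := fun i => mod_cast contDiff_infty.1 (hψ' i) 1
  have hψc := hψ.continuous
  have e : ∀ R : ℝ, 0 < R → ∫ y, Laplacian.laplacian v (x₀ + R • y) * ψ y =
      ∑ i, (R ^ 2)⁻¹ * ∫ y, v (x₀ + R • y) * partialDeriv i (partialDeriv i ψ) y := by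
    intro R hR
    simp only [laplacian_eq_sum_partialDeriv hv, Finset.sum_mul]
    rw [integral_finsetSum _ fun i _ => by
      have := h2 i
      exact Continuous.integrable_of_hasCompactSupport (by fun_prop) hc.mul_left]
    refine Finset.sum_congr rfl fun i _ => ?_
    rw [integral_comp_mul_partialDeriv i (hv.of_le (by norm_num)) (hψ1' i)
      (hasCompactSupport_partialDeriv i hc), integral_comp_mul_partialDeriv i (h1 i) hψ1 hc]
    field_simp
  have lim : Tendsto (fun R : ℝ => ∑ i, (R ^ 2)⁻¹ *
      ∫ y, v (x₀ + R • y) * partialDeriv i (partialDeriv i ψ) y) atTop (𝓝 0) := by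
    rw [show (0 : ℝ) = ∑ _i : Fin n, 0 * 0 by simp]
    exact tendsto_finsetSum _ fun i _ =>
      ((tendsto_pow_atTop two_ne_zero).inv_tendsto_atTop).mul
      (h _ (contDiff_partialDeriv i (hψ' i) (by simp))
        (hasCompactSupport_partialDeriv i (hasCompactSupport_partialDeriv i hc)) x₀)
  refine lim.congr' ?_
  filter_upwards [eventually_gt_atTop 0] with R hR using (e R hR).symm

/-! ### A radial weight and the Liouville-type argument -/

/-- The radial profile `t ↦ exp(-1/(1-t))`, cut off at `t = 1`. -/
def radialProfile (t : ℝ) : ℝ := expNegInvGlue (1 - t)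

theorem contDiff_radialProfile {k : ℕ∞} : ContDiff ℝ k radialProfile :=
  expNegInvGlue.contDiff.comp (contDiff_const.sub contDiff_id)

theorem radialProfile_eq_zero {t : ℝ} (ht : 1 ≤ t) : radialProfile t = 0 :=
  expNegInvGlue.zero_of_nonpos (by linarith)

theorem deriv_radialProfile_nonpos (t : ℝ) : deriv radialProfile t ≤ 0 :=
  Antitone.deriv_nonpos fun _ _ h => expNegInvGlue.monotone (by linarith)

theorem exists_deriv_radialProfile_ne_zero : ∃ t : ℝ, 0 < t ∧ deriv radialProfile t ≠ 0 := by
  obtain ⟨c, hc, h⟩ := exists_deriv_eq_slope radialProfile one_pos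
    (contDiff_radialProfile (k := 0)).continuous.continuousOn
    ((contDiff_radialProfile (k := 1)).differentiable one_ne_zero).differentiableOn
  refine ⟨c, hc.1, ?_⟩
  rw [h, radialProfile_eq_zero le_rfl]
  have : 0 < radialProfile 0 := expNegInvGlue.pos_of_pos (by norm_num)
  simp [this.ne']

theorem deriv_radialProfile_eq_zero {t : ℝ} (ht : 1 < t) : deriv radialProfile t = 0 := by
  have : radialProfile =ᶠ[𝓝 t] fun _ => 0 := by
    filter_upwards [lt_mem_nhds ht] with s hs using radialProfile_eq_zero hs.le
  rw [this.deriv_eq]; simp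

/-- A smooth compactly supported radial potential. -/
def radialPotential (n : ℕ) (y : Rn n) : ℝ := radialProfile (‖y‖ ^ 2)

/-- The nonnegative radial weight `φ` with `φ(y) y = -∇Φ(y)`, `Φ` the radial potential. -/
def radialWeight (n : ℕ) (y : Rn n) : ℝ := -(2 * deriv radialProfile (‖y‖ ^ 2))

theorem contDiff_radialPotential {k : ℕ∞} : ContDiff ℝ k (radialPotential n) :=
  contDiff_radialProfile.comp (contDiff_norm_sq ℝ)

theorem hasCompactSupport_radialPotential : HasCompactSupport (radialPotential n) := by
  refine HasCompactSupport.of_support_subset_isCompact (isCompact_closedBall (0 : Rn n) 1)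
    fun y hy => ?_
  by_contra h
  rw [mem_closedBall_zero_iff, not_le] at h
  exact hy (radialProfile_eq_zero (by nlinarith))

theorem contDiff_radialWeight : ContDiff ℝ (⊤ : ℕ∞) (radialWeight n) := by
  have : ContDiff ℝ (⊤ : ℕ∞) (deriv radialProfile) :=
    ((contDiff_infty_iff_deriv).1 contDiff_radialProfile).2
  exact (contDiff_const.mul (this.comp (contDiff_norm_sq ℝ))).neg

theorem hasCompactSupport_radialWeight : HasCompactSupport (radialWeight n) := by
  refine HasCompactSupport.of_support_subset_isCompact (isCompact_closedBall (0 : Rn n) 1)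
    fun y hy => ?_
  by_contra h
  rw [mem_closedBall_zero_iff, not_le] at h
  refine hy ?_
  rw [radialWeight, deriv_radialProfile_eq_zero (by nlinarith)]
  simp

theorem integral_radialWeight_pos (hn : 1 ≤ n) : 0 < ∫ y, radialWeight n y := by
  obtain ⟨t, ht, h⟩ := exists_deriv_radialProfile_ne_zero
  have : Nonempty (Fin n) := ⟨⟨0, hn⟩⟩
  obtain ⟨y, hy⟩ := exists_norm_eq (Rn n) (Real.sqrt_nonneg t)
  refine contDiff_radialWeight.continuous.integral_pos_of_hasCompactSupport_nonneg_nonzero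
    hasCompactSupport_radialWeight (fun y => ?_) (x := y) ?_
  · simp only [radialWeight, Pi.zero_apply]
    linarith [deriv_radialProfile_nonpos (‖y‖ ^ 2)]
  · rw [radialWeight, hy, Real.sq_sqrt ht.le]
    simpa using h

theorem partialDeriv_radialPotential (i : Fin n) (y : Rn n) :
    partialDeriv i (radialPotential n) y =
      -(inner ℝ (EuclideanSpace.basisFun (Fin n) ℝ i) y * radialWeight n y) := by
  have h1 : HasDerivAt radialProfile (deriv radialProfile (‖y‖ ^ 2)) (‖y‖ ^ 2) :=
    ((contDiff_radialProfile (k := 1)).differentiable one_ne_zero _).hasDerivAt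
  have h2 : HasFDerivAt (fun y : Rn n => ‖y‖ ^ 2) (2 • innerSL ℝ y) y :=
    (hasStrictFDerivAt_norm_sq y).hasFDerivAt
  have h3 := h1.comp_hasFDerivAt y h2
  have h4 : HasFDerivAt (radialPotential n) _ y := h3
  rw [partialDeriv, h4.fderiv, real_inner_comm]
  simp [radialWeight]
  ring

theorem hasDerivAt_integral_comp_add_smul {v φ : Rn n → ℝ} (hv : ContDiff ℝ 1 v)
    (hφ : Continuous φ) (hc : HasCompactSupport φ) (x₀ : Rn n) (R₀ : ℝ) :
    HasDerivAt (fun R : ℝ => ∫ y, v (x₀ + R • y) * φ y)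
      (∫ y, fderiv ℝ v (x₀ + R₀ • y) y * φ y) R₀ := by
  have hvc := hv.continuous
  have hvc' := hv.continuous_fderiv one_ne_zero
  have hF' : Continuous fun p : ℝ × Rn n => fderiv ℝ v (x₀ + p.1 • p.2) p.2 :=
    (hvc'.comp (by fun_prop : Continuous fun p : ℝ × Rn n => x₀ + p.1 • p.2)).clm_apply
      continuous_snd
  obtain ⟨M, hM⟩ := ((isCompact_closedBall R₀ 1).prod hc.isCompact).exists_bound_of_continuousOn
    hF'.continuousOn
  refine (hasDerivAt_integral_of_dominated_loc_of_deriv_le (s := Metric.closedBall R₀ 1)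
    (bound := fun y => M * ‖φ y‖) (F' := fun R y => fderiv ℝ v (x₀ + R • y) y * φ y)
    (Metric.closedBall_mem_nhds _ one_pos) (Eventually.of_forall fun R =>
      (by fun_prop : Continuous fun y => v (x₀ + R • y) * φ y).aestronglyMeasurable)
    (Continuous.integrable_of_hasCompactSupport (by fun_prop) hc.mul_left)
    ((hF'.comp (by fun_prop : Continuous fun y => (R₀, y))).mul hφ).aestronglyMeasurable
    (Eventually.of_forall fun y R hR => ?_)
    ((hφ.integrable_of_hasCompactSupport hc).norm.const_mul M)
    (Eventually.of_forall fun y R _ => ?_)).2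
  · rw [norm_mul]
    by_cases hy : φ y = 0
    · simp [hy]
    · gcongr
      exact hM (R, y) ⟨hR, subset_tsupport φ hy⟩
  · have h1 : HasDerivAt (fun R : ℝ => x₀ + R • y) y R := by
      simpa using ((hasDerivAt_id R).smul_const y).const_add x₀
    exact (((hv.differentiable one_ne_zero _).hasFDerivAt).comp_hasDerivAt R h1).mul_const _

/-- Because the weight times y is -∇Φ, the integrand is -∇v(x₀ + R y) · ∇Φ(y); one integration by
parts gives the Laplacian and the chain rule gives R. -/
theorem integral_fderiv_mul_radialWeight {v : Rn n → ℝ} (hv : ContDiff ℝ 2 v) (x₀ : Rn n) (R : ℝ) :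
    ∫ y, fderiv ℝ v (x₀ + R • y) y * radialWeight n y =
      R * ∫ y, Laplacian.laplacian v (x₀ + R • y) * radialPotential n y := by
  have h1 : ∀ i, ContDiff ℝ 1 (partialDeriv i v) := fun i =>
    contDiff_partialDeriv i hv (by norm_num)
  have h2 : ∀ i, Continuous (partialDeriv i (partialDeriv i v)) := fun i =>
    (contDiff_partialDeriv (k := 0) i (h1 i) (by norm_num)).continuous
  have hΦ : ContDiff ℝ 1 (radialPotential n) := contDiff_radialPotential (k := 1)
  have hc := hasCompactSupport_radialPotential (n := n)
  have hΦc := hΦ.continuous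
  have hΦ' : ∀ i, Continuous (partialDeriv i (radialPotential n)) := fun i =>
    (contDiff_partialDeriv (k := 0) i hΦ (by norm_num)).continuous
  have e : ∀ y, fderiv ℝ v (x₀ + R • y) y * radialWeight n y =
      ∑ i, -(partialDeriv i v (x₀ + R • y) * partialDeriv i (radialPotential n) y) := by
    intro y
    conv_lhs => rw [← (EuclideanSpace.basisFun (Fin n) ℝ).sum_repr' y]
    rw [map_sum, Finset.sum_mul]
    refine Finset.sum_congr rfl fun i _ => ?_
    rw [partialDeriv_radialPotential, map_smul, partialDeriv,
      (EuclideanSpace.basisFun (Fin n) ℝ).sum_repr' y, smul_eq_mul]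
    ring
  simp only [e, laplacian_eq_sum_partialDeriv hv, Finset.sum_mul]
  rw [integral_finsetSum _ fun i _ => by
      have := (h1 i).continuous
      have := hΦ' i
      exact (Continuous.integrable_of_hasCompactSupport (by fun_prop)
        (hasCompactSupport_partialDeriv i hc).mul_left).neg,
    integral_finsetSum _ fun i _ => by
      have := h2 i
      exact Continuous.integrable_of_hasCompactSupport (by fun_prop) hc.mul_left,
    Finset.mul_sum]
  refine Finset.sum_congr rfl fun i _ => ?_
  rw [integral_neg, integral_comp_mul_partialDeriv i (h1 i) hΦ hc, neg_neg]

/-- A subharmonic function whose rescaled averages vanish at infinity is nonpositive. -/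
theorem AveragesVanish.nonpos {v : Rn n → ℝ} (h : AveragesVanish v) (hn : 1 ≤ n)
    (hv : ContDiff ℝ 2 v) (hsub : ∀ x, 0 ≤ Laplacian.laplacian v x) (x₀ : Rn n) : v x₀ ≤ 0 := by
  set f : ℝ → ℝ := fun R => ∫ y, v (x₀ + R • y) * radialWeight n y
  have hd : ∀ R, HasDerivAt f
      (R * ∫ y, Laplacian.laplacian v (x₀ + R • y) * radialPotential n y) R := fun R => by
    rw [← integral_fderiv_mul_radialWeight hv]
    exact hasDerivAt_integral_comp_add_smul (hv.of_le (by norm_num))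
      contDiff_radialWeight.continuous hasCompactSupport_radialWeight x₀ R
  -- The derivative is R times the integral of Δv against Φ, and both Δv and Φ are nonnegative.
  have hmono : MonotoneOn f (Set.Ici 0) := by
    refine monotoneOn_of_deriv_nonneg (convex_Ici 0)
      (fun R _ => (hd R).continuousAt.continuousWithinAt)
      (fun R _ => (hd R).differentiableAt.differentiableWithinAt) fun R hR => ?_
    rw [interior_Ici] at hR
    rw [(hd R).deriv]
    exact mul_nonneg (le_of_lt hR) (integral_nonneg fun y =>
      mul_nonneg (hsub _) (expNegInvGlue.nonneg _))
  have hlim : Tendsto f atTop (𝓝 0) :=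
    h _ contDiff_radialWeight hasCompactSupport_radialWeight x₀
  have h0 : f 0 ≤ 0 := by
    refine ge_of_tendsto hlim ?_
    filter_upwards [eventually_ge_atTop 0] with R hR
    exact hmono Set.self_mem_Ici hR hR
  have e0 : f 0 = v x₀ * ∫ y, radialWeight n y := by
    simp [f, integral_const_mul]
  rw [e0] at h0
  by_contra! hpos
  exact absurd h0 (not_le.2 (mul_pos hpos (integral_radialWeight_pos hn)))

/-! ### From the stated hypotheses to the conclusion -/

theorem HolderLoc.holderOnBalls {k : ℕ} {β : ℝ≥0} {u : Rn n → ℝ} (h : HolderLoc k β u) :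
    HolderOnBalls β (iteratedFDeriv ℝ k u) := by
  intro R
  obtain ⟨C, hC⟩ := h.2 _ (isCompact_closedBall (0 : Rn n) R)
  refine ⟨C, C.2, fun x y hx hy => ?_⟩
  simpa only [dist_eq_norm] using
    hC.dist_le (mem_closedBall_zero_iff.2 hx) (mem_closedBall_zero_iff.2 hy)

theorem InWeightedL1.integrable {α : ℝ} (hα : 0 < α) {u : Rn n → ℝ} (h : InWeightedL1 α u)
    (hu : Continuous u) :
    Integrable fun y => |u y| * (1 + ‖y‖) ^ (-((n : ℝ) + α)) := by
  have hs : 0 < (n : ℝ) + α := by positivity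
  -- The constant 2 comes from 1 + ‖y‖^s ≤ 2 (1 + ‖y‖)^s.
  refine (h.const_mul 2).mono' (hu.abs.mul (Continuous.rpow_const (by fun_prop)
    fun z => Or.inl (by positivity))).aestronglyMeasurable (Eventually.of_forall fun y => ?_)
  rw [Real.norm_of_nonneg (by positivity), Real.rpow_neg (by positivity), ← div_eq_mul_inv,
    ← mul_div_assoc, div_le_div_iff₀ (by positivity) (by positivity)]
  have h1 : 1 ≤ (1 + ‖y‖) ^ ((n : ℝ) + α) :=
    Real.one_le_rpow (by linarith [norm_nonneg y]) hs.le
  have h2 : ‖y‖ ^ ((n : ℝ) + α) ≤ (1 + ‖y‖) ^ ((n : ℝ) + α) := by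
    gcongr; linarith
  nlinarith [abs_nonneg (u y)]

/-- A function of class `C^{k+[α],{α}+ε}_loc` in the weighted space is admissible, and its singular
integral of order `α` is of class `C^k`. -/
theorem FracRegular.exists_isAdmissible (hn : 1 ≤ n) {k : ℕ} {α : ℝ} (hα0 : 0 < α) (hα2 : α < 2)
    {u : Rn n → ℝ} (hu : FracRegular k α u) (hw : InWeightedL1 α u) :
    ∃ β, IsAdmissible ((n : ℝ) + α) β u ∧
      ContDiff ℝ (k : WithTop ℕ∞) (singularIntegral ((n : ℝ) + α) u) := by
  obtain ⟨ε, hε, hlt, hH⟩ := hu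
  set γ : ℝ := Int.fract α + ε
  have hγ0 : 0 ≤ γ := add_nonneg (Int.fract_nonneg _) hε.le
  have ha : ⌊α⌋₊ ≤ 1 := by
    have : ⌊α⌋₊ < 2 := (Nat.floor_lt hα0.le).2 (by exact_mod_cast hα2)
    omega
  -- The order of the second differences is α + ε, so ε is exactly the margin in s < n + β.
  have hαγ : α + ε = ⌊α⌋₊ + γ := by
    rw [natCast_floor_eq_intCast_floor hα0.le]
    simp only [γ, Int.fract]; ring
  have hh : HolderOnBalls γ (iteratedFDeriv ℝ (k + ⌊α⌋₊) u) := by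
    simpa only [Real.coe_toNNReal _ hγ0] using hH.holderOnBalls
  have hA : IsAdmissible ((n : ℝ) + α) (⌊α⌋₊ + γ) u :=
    { dim_pos := hn
      dim_lt := by linarith
      lt_add := by linarith
      cont := hH.1.continuous
      weighted := hw.integrable hα0 hH.1.continuous
      bound := secondDiffBound_of_contDiff ha hγ0 hlt.le k hH.1 hh }
  exact ⟨_, hA, hA.contDiff_singularIntegral ha hγ0 hlt.le k hH.1 hh⟩

theorem contDiff_iterate_negLaplacian {w : Rn n → ℝ} {m : ℕ}
    (hw : ContDiff ℝ ((2 * m : ℕ) : WithTop ℕ∞) w) {i : ℕ} (hi : i ≤ m) :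
    ContDiff ℝ ((2 * (m - i) : ℕ) : WithTop ℕ∞) (negLaplacian^[i] w) := by
  induction i with
  | zero => exact hw
  | succ i ih =>
    rw [Function.iterate_succ_apply']
    refine (contDiff_laplacian ?_).neg
    rw [show 2 * (m - (i + 1)) + 2 = 2 * (m - i) by omega]
    exact ih (by omega)

theorem AveragesVanish.negLaplacian {v : Rn n → ℝ} (h : AveragesVanish v) (hv : ContDiff ℝ 2 v) :
    AveragesVanish (negLaplacian v) := by
  have := (h.laplacian hv).const_mul (-1)
  simp only [neg_one_mul] at this
  exact this

theorem AveragesVanish.iterate_negLaplacian {w : Rn n → ℝ} (h : AveragesVanish w) {m : ℕ}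
    (hw : ContDiff ℝ ((2 * m : ℕ) : WithTop ℕ∞) w) {i : ℕ} (hi : i ≤ m) :
    AveragesVanish (HigherFrac.negLaplacian^[i] w) := by
  induction i with
  | zero => exact h
  | succ i ih =>
    rw [Function.iterate_succ_apply']
    exact (ih (by omega)).negLaplacian
      ((contDiff_iterate_negLaplacian hw (by omega)).of_le (by norm_cast; omega))

/-- Descending induction: nonpositivity at order i + 1 says that the iterate of order i is
subharmonic, and its averages vanish. -/
theorem AveragesVanish.iterate_negLaplacian_nonpos {w : Rn n → ℝ} (h : AveragesVanish w)
    (hn : 1 ≤ n) {m : ℕ} (hw : ContDiff ℝ ((2 * m : ℕ) : WithTop ℕ∞) w)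
    (hm : ∀ x, (HigherFrac.negLaplacian^[m] w) x ≤ 0) {i : ℕ} (hi : i ≤ m) (x : Rn n) :
    (HigherFrac.negLaplacian^[i] w) x ≤ 0 := by
  induction hi using Nat.decreasingInduction generalizing x with
  | self => exact hm x
  | of_succ i hi ih =>
    refine (h.iterate_negLaplacian hw hi.le).nonpos hn
      ((contDiff_iterate_negLaplacian hw hi.le).of_le (by norm_cast; omega)) (fun y => ?_) x
    have := ih y
    rw [Function.iterate_succ_apply'] at this
    exact neg_nonpos.1 this

end HigherFrac

end

theorem theorem1p2 (n m : ℕ) (hn : 2 ≤ n) (hm : 1 ≤ m) (α : ℝ) (hα0 : 0 < α) (hα2 : α < 2)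
    (f : HigherFrac.Rn n → FormalMultilinearSeries ℝ (HigherFrac.Rn n) ℝ → ℝ)
    (u : HigherFrac.Rn n → ℝ)
    (hu : HigherFrac.IsNonnegClassicalSolution m α f u)
    (hf_cont : Continuous fun x => f x (ftaylorSeries ℝ u x))
    (hf_nonpos : ∀ x, f x (ftaylorSeries ℝ u x) ≤ 0) :
    -- the operators below are well defined pointwise
    (∀ x, ∃ L : ℝ, Tendsto (HigherFrac.truncFracLaplacian α u x) (𝓝[>] (0 : ℝ)) (𝓝 L)) ∧
    ContDiff ℝ ((2 * m : ℕ) : WithTop ℕ∞) (HigherFrac.fracLaplacian α u) ∧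
    -- the sub poly-harmonic property
    ∀ i : ℕ, i < m → ∀ x, HigherFrac.higherFracLaplacian i α u x ≤ 0 := by
  have hn1 : 1 ≤ n := by omega
  obtain ⟨β, hA, hC⟩ := hu.regular.exists_isAdmissible hn1 hα0 hα2 hu.weighted
  have hw : ContDiff ℝ ((2 * m : ℕ) : WithTop ℕ∞) (HigherFrac.fracLaplacian α u) := by
    rw [hA.fracLaplacian_eq]
    exact contDiff_const.mul hC
  have hv : HigherFrac.AveragesVanish (HigherFrac.fracLaplacian α u) := by
    rw [hA.fracLaplacian_eq]
    exact (hA.averagesVanish (by linarith)).const_mul _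
  refine ⟨fun x => ⟨_, hA.tendsto_truncFracLaplacian x⟩, hw, fun i hi x => ?_⟩
  exact hv.iterate_negLaplacian_nonpos hn1 hw
    (fun y => (hu.equation y).trans_le (hf_nonpos y)) hi.le x
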